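/- Let $p,q:[0,\infty)\to\mathbb R$ be continuously differentiable, put $J=\begin{bmatrix}0&1\\-1&0\end{bmatrix}$, $\mathcal V=\begin{bmatrix}p&q\\q&-p\end{bmatrix}$, and suppose $\|\mathcal V(x)\|\le M_1$ for all $x\ge 0$ (operator norm). Put $M=2\sqrt2\,M_1$. Consider the dynamical Dirac system $$\mathrm i u_t+Ju_x+\mathcal V u=0\quad(x\ge0,\ t\ge0),\qquad u(x,0)=0,\quad u_1(0,t)=f(t),$$ where the control $f:\mathbb R\to\mathbb C$ is continuously differentiable and vanishes for $t\le 0$, and solutions $u=\begin{bmatrix}u_1\\u_2\end{bmatrix}$ are classical (continuously differentiable in the closed quarter-plane). Its response function is a continuous function $r:[0,\infty)\to\mathbb C$ such that, for every such $f$ and every such solution $u$, $$u_2(0,t)=\mathrm i f(t)+\int_0^t r(t-s)f(s)\,ds\qquad(t\ge0).$$ Consider also the spectral Dirac system $$y'(x,z)=\mathrm i\,(zj+jV(x))\,y(x,z)\quad(x\ge0),\qquad j=\begin{bmatrix}1&0\\0&-1\end{bmatrix},\quad V=\begin{bmatrix}0&v\\ \overline v&0\end{bmatrix},\quad v=\mathrm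 i q-p,$$ with fundamental solution $Y(x,z)$, $Y(0,z)=I_2$. The Weyl function $\varphi$ is determined by $$\int_0^\infty\begin{bmatrix}1&\overline{\varphi(z)}\end{bmatrix}Y(x,z)^*Y(x,z)\begin{bmatrix}1\\ \varphi(z)\end{bmatrix}dx<\infty ,$$ and the Herglotz-type Weyl function $\varphi_H$ by $$\int_0^\infty\begin{bmatrix}1&\mathrm i\,\overline{\varphi_H(z)}\end{bmatrix}K\,Y(x,z)^*Y(x,z)\,K^*\begin{bmatrix}1\\ -\mathrm i\varphi_H(z)\end{bmatrix}dx<\infty ,\qquad K=\frac1{\sqrt2}\begin{bmatrix}1&-1\\1&1\end{bmatrix}.$$ Then the response function $r$ exists, and for every $z$ with $\operatorname{Im}z>M$ the integral $\widehat r(z)=\int_0^\infty \mathrm e^{\mathrm i zt}r(t)\,dt$ converges absolutely, $\widehat r(z)+2\mathrm i\ne0$, there is exactly one value $\varphi(z)$ and exactly one value $\varphi_H(z)$ satisfying the respective inequality above, and $$\varphi(z)=\frac{\widehat r(z)}{\widehat r(z)+2\mathrm i},\qquad \varphi_H(z)=\widehat r(z)+\mathrm i .$$ -/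

import Mathlib

open Set MeasureTheory Complex
open scoped Matrix

noncomputable section

/-! ### The dynamical Dirac system -/

/-- The matrix `J` of the dynamical Dirac system. -/
def dynJ : Matrix (Fin 2) (Fin 2) ℂ := !![0, 1; -1, 0]

/-- The potential `𝒱(x)` of the dynamical Dirac system, built from the real functions `p`, `q`. -/
def dynV (p q : ℝ → ℝ) (x : ℝ) : Matrix (Fin 2) (Fin 2) ℂ :=
  !![(p x : ℂ), (q x : ℂ); (q x : ℂ), -(p x : ℂ)]

/-- Boundary controls: continuously differentiable functions on `[0, ∞)` with
`f(0) = f'(0) = 0`, extended by zero to the negative half-line. -/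
def IsControl (f : ℝ → ℂ) : Prop := ContDiff ℝ 1 f ∧ ∀ t ≤ 0, f t = 0

/-- `u(x, t)` is a classical solution of `i u_t + J u_x + 𝒱 u = 0` in the closed quarter-plane
`x ≥ 0`, `t ≥ 0`, with `u(x, 0) = 0` and `u₁(0, t) = f(t)`. Derivatives at the boundary of the
quarter-plane are one-sided. -/
structure IsClassicalSolution (p q : ℝ → ℝ) (f : ℝ → ℂ) (u : ℝ → ℝ → Fin 2 → ℂ) : Prop where
  contDiffOn : ContDiffOn ℝ 1 (fun y : ℝ × ℝ => u y.1 y.2) (Ici 0 ×ˢ Ici 0)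
  equation : ∀ x, 0 ≤ x → ∀ t, 0 ≤ t →
    I • derivWithin (fun s => u x s) (Ici 0) t
      + dynJ *ᵥ derivWithin (fun y => u y t) (Ici 0) x
      + dynV p q x *ᵥ u x t = 0
  initial : ∀ x, 0 ≤ x → u x 0 = 0
  boundary : ∀ t, 0 ≤ t → u 0 t 0 = f t

/-- `r` is the response function: the response operator `R : u₁(0, ·) ↦ u₂(0, ·)` acts as
`R f = i f + r * f`. Only the values of `r` on `[0, ∞)` matter. -/
def IsResponseFunction (p q : ℝ → ℝ) (r : ℝ → ℂ) : Prop :=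
  ContinuousOn r (Ici 0) ∧
    ∀ f u, IsControl f → IsClassicalSolution p q f u →
      ∀ t, 0 ≤ t → u 0 t 1 = I * f t + ∫ s in (0 : ℝ)..t, r (t - s) * f s

/-- The Fourier-Laplace transform `∫₀^∞ e^{izt} r(t) dt`. -/
def fourierLaplace (r : ℝ → ℂ) (z : ℂ) : ℂ :=
  ∫ t in Ioi (0 : ℝ), exp (I * z * t) * r t

/-! ### The spectral Dirac system with `m₁ = m₂ = 1` -/

/-- The matrix `j = diag(1, -1)`. -/
def specj : Matrix (Fin 2) (Fin 2) ℂ := !![1, 0; 0, -1]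

/-- The potential `V(x)` of the spectral Dirac system, built from the scalar function `v`. -/
def specV (v : ℝ → ℂ) (x : ℝ) : Matrix (Fin 2) (Fin 2) ℂ :=
  !![0, v x; star (v x), 0]

/-- `Y(·)` is the fundamental solution on `[0, ∞)` of `y' = i (z j + j V) y`, normalized by
`Y(0) = I₂` (classical solution; `v` is continuous in all uses). -/
def IsFundamentalSolution (v : ℝ → ℂ) (z : ℂ) (Y : ℝ → Matrix (Fin 2) (Fin 2) ℂ) : Prop :=
  Y 0 = 1 ∧ ∀ x, 0 ≤ x → ∀ i k,
    HasDerivWithinAt (fun s => Y s i k)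
      (((I • (z • specj + specj * specV v x)) * Y x) i k) (Ici 0) x

/-- `∫₀^∞ h* Y(x,z)* Y(x,z) h dx < ∞` for the fundamental solution `Y`. -/
def SquareSummableAlong (v : ℝ → ℂ) (z : ℂ) (h : Fin 2 → ℂ) : Prop :=
  ∃ Y, IsFundamentalSolution v z Y ∧
    IntegrableOn (fun x => star h ⬝ᵥ (((Y x)ᴴ * Y x) *ᵥ h)) (Ioi 0)

/-- `w` is a value at `z` of the (contractive) Weyl function `φ`:
`∫₀^∞ [1, w*] Y* Y [1; w] dx < ∞`. -/
def IsWeylValue (v : ℝ → ℂ) (z w : ℂ) : Prop :=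
  SquareSummableAlong v z ![1, w]

/-- The unitary matrix `K = 2^{-1/2} [1, -1; 1, 1]`. -/
def herglotzK : Matrix (Fin 2) (Fin 2) ℂ :=
  ((Real.sqrt 2 : ℝ) : ℂ)⁻¹ • !![1, -1; 1, 1]

/-- `w` is a value at `z` of the Herglotz-type Weyl function `φ_H`:
`∫₀^∞ [1, i w*] K Y* Y K* [1; -i w] dx < ∞`. -/
def IsHerglotzWeylValue (v : ℝ → ℂ) (z w : ℂ) : Prop :=
  SquareSummableAlong v z (herglotzKᴴ *ᵥ ![1, -I * w])

end

/-! ### Calculus preliminaries -/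

section Calculus

open Filter Topology

variable {E : Type*} [NormedAddCommGroup E] [NormedSpace ℝ E]

theorem norm_integral_le_of_radial {f : ℝ → E} {G G' : ℝ → ℝ} {c d : ℝ}
    (hG : ∀ r, HasDerivAt G (G' r) r) (hG' : Continuous G')
    (h : ∀ y ∈ uIcc c d, ‖f y‖ ≤ G' |y - c|) :
    ‖∫ y in c..d, f y‖ ≤ G |d - c| - G 0 := by
  rcases le_total c d with hcd | hcd
  · have h1 : ∫ y in c..d, G' (y - c) = G (d - c) - G 0 := by
      have := intervalIntegral.integral_eq_sub_of_hasDerivAt (a := c) (b := d)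
        (f := fun y => G (y - c)) (f' := fun y => G' (y - c))
        (fun y _ => (hG (y - c)).comp_sub_const y c)
        ((hG'.comp (continuous_id.sub continuous_const)).intervalIntegrable _ _)
      simpa using this
    rw [abs_of_nonneg (sub_nonneg.2 hcd), ← h1]
    refine intervalIntegral.norm_integral_le_of_norm_le hcd (.of_forall fun y hy => ?_)
      ((hG'.comp (continuous_id.sub continuous_const)).intervalIntegrable _ _)
    have := h y (by rw [uIcc_of_le hcd]; exact Ioc_subset_Icc_self hy)
    rwa [abs_of_nonneg (sub_nonneg.2 hy.1.le)] at this
  · have h1 : ∫ y in d..c, G' (c - y) = G (c - d) - G 0 := by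
      have := intervalIntegral.integral_eq_sub_of_hasDerivAt (a := d) (b := c)
        (f := fun y => - G (c - y)) (f' := fun y => G' (c - y))
        (fun y _ => ((hG (c - y)).comp_const_sub c y).neg.congr_deriv (neg_neg _))
        ((hG'.comp (continuous_const.sub continuous_id)).intervalIntegrable _ _)
      rw [this]; simp; ring
    rw [abs_of_nonpos (sub_nonpos.2 hcd), neg_sub, ← h1, intervalIntegral.integral_symm, norm_neg]
    refine intervalIntegral.norm_integral_le_of_norm_le hcd (.of_forall fun y hy => ?_)
      ((hG'.comp (continuous_const.sub continuous_id)).intervalIntegrable _ _)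
    have := h y (by rw [uIcc_of_ge hcd]; exact Ioc_subset_Icc_self hy)
    rwa [abs_of_nonpos (sub_nonpos.2 hy.2), neg_sub] at this

theorem norm_integral_le_of_exp_growth {f : ℝ → E} {D κ c d : ℝ} (hκ : 0 < κ)
    (h : ∀ y ∈ uIcc c d, ‖f y‖ ≤ D * Real.exp (κ * |y - c|)) :
    ‖∫ y in c..d, f y‖ ≤ D / κ * (Real.exp (κ * |d - c|) - 1) := by
  have := norm_integral_le_of_radial (f := f) (G := fun r => D / κ * Real.exp (κ * r))
    (G' := fun r => D * Real.exp (κ * r)) (c := c) (d := d)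
    (fun r => by
      refine (((hasDerivAt_id r).const_mul κ).exp.const_mul (D / κ)).congr_deriv ?_
      simp; field_simp) (by fun_prop) h
  calc _ ≤ _ := this
    _ = _ := by simp; ring

theorem norm_integral_le_of_exp_decay {f : ℝ → E} {D κ c d : ℝ} (hκ : 0 < κ) (hD : 0 ≤ D)
    (h : ∀ y ∈ uIcc c d, ‖f y‖ ≤ D * Real.exp (-κ * |y - c|)) :
    ‖∫ y in c..d, f y‖ ≤ D / κ := by
  have := norm_integral_le_of_radial (f := f) (G := fun r => -(D / κ) * Real.exp (-κ * r))
    (G' := fun r => D * Real.exp (-κ * r)) (c := c) (d := d)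
    (fun r => by
      refine (((hasDerivAt_id r).const_mul (-κ)).exp.const_mul (-(D / κ))).congr_deriv ?_
      simp; field_simp) (by fun_prop) h
  refine this.trans ?_
  have : 0 ≤ D / κ * Real.exp (-κ * |d - c|) := by positivity
  simp at this ⊢; linarith

theorem hasDerivAt_intervalIntegral_param {K K' : ℝ → ℝ → E}
    (hK : Continuous (Function.uncurry K)) (hK' : Continuous (Function.uncurry K'))
    (h : ∀ s y, HasDerivAt (fun s => K s y) (K' s y) s) (a b s : ℝ) :
    HasDerivAt (fun s => ∫ y in a..b, K s y) (∫ y in a..b, K' s y) s := by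
  obtain ⟨C, hC⟩ := ((isCompact_Icc (a := s - 1) (b := s + 1)).prod
    (isCompact_uIcc (a := a) (b := b))).exists_bound_of_continuousOn hK'.continuousOn
  refine (intervalIntegral.hasDerivAt_integral_of_dominated_loc_of_deriv_le
    (s := Icc (s - 1) (s + 1)) (bound := fun _ => C) (Icc_mem_nhds (by linarith) (by linarith))
    (.of_forall fun x => ?_) ?_ ?_ (.of_forall fun y hy x hx => ?_)
    intervalIntegrable_const (.of_forall fun y _ x _ => h x y)).2
  · exact (hK.uncurry_left x).aestronglyMeasurable
  · exact (hK.uncurry_left s).intervalIntegrable _ _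
  · exact (hK'.uncurry_left s).aestronglyMeasurable
  · exact hC (x, y) ⟨hx, uIoc_subset_uIcc hy⟩

theorem eq_zero_of_hasDerivAt_of_eqOn_zero {D D' : ℝ → E} (h : ∀ t, HasDerivAt D (D' t) t)
    (h0 : ∀ t, 0 ≤ t → D t = 0) (t : ℝ) (ht : 0 ≤ t) : D' t = 0 := by
  have h1 := (h t).hasDerivWithinAt (s := Ici 0)
  have h2 : HasDerivWithinAt D 0 (Ici 0) t :=
    (hasDerivWithinAt_const t (Ici 0) (0 : E)).congr (fun s hs => h0 s hs) (h0 t ht)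
  exact (uniqueDiffOn_Ici (0 : ℝ) t ht).eq_deriv _ h1 h2

variable [CompleteSpace E]

theorem hasStrictFDerivAt_primitive_param {K K' : ℝ → ℝ → E}
    (hK : Continuous (Function.uncurry K)) (hK' : Continuous (Function.uncurry K'))
    (h : ∀ s y, HasDerivAt (fun s => K s y) (K' s y) s) (a : ℝ) (u : ℝ × ℝ) :
    HasStrictFDerivAt (fun u : ℝ × ℝ => ∫ y in a..u.2, K u.1 y)
      ((ContinuousLinearMap.toSpanSingleton ℝ (∫ y in a..u.2, K' u.1 y)).coprod
        (ContinuousLinearMap.toSpanSingleton ℝ (K u.1 u.2))) u := by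
  have hc : Continuous fun u : ℝ × ℝ => ∫ y in a..u.2, K' u.1 y :=
    intervalIntegral.continuous_parametric_primitive_of_continuous hK'
  exact hasStrictFDerivAt_uncurry_coprod (u := u) (f := fun s x => ∫ y in a..x, K s y)
    (f₁ := fun s x => ContinuousLinearMap.toSpanSingleton ℝ (∫ y in a..x, K' s y))
    (f₂ := fun s x => ContinuousLinearMap.toSpanSingleton ℝ (K s x))
    (.of_forall fun v => (hasDerivAt_intervalIntegral_param hK hK' h a v.2 v.1).hasFDerivAt)
    (.of_forall fun v => ((hK.uncurry_left v.1).integral_hasStrictDerivAt a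
      v.2).hasDerivAt.hasFDerivAt)
    ((ContinuousLinearMap.toSpanSingletonCLE (𝕜 := ℝ) (E := E)).continuous.comp hc).continuousAt
    ((ContinuousLinearMap.toSpanSingletonCLE (𝕜 := ℝ) (E := E)).continuous.comp hK).continuousAt

theorem contDiff_primitive_param {K K' : ℝ → ℝ → E}
    (hK : Continuous (Function.uncurry K)) (hK' : Continuous (Function.uncurry K'))
    (h : ∀ s y, HasDerivAt (fun s => K s y) (K' s y) s) (a : ℝ) :
    ContDiff ℝ 1 (fun u : ℝ × ℝ => ∫ y in a..u.2, K u.1 y) := by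
  have hc : Continuous fun u : ℝ × ℝ => ∫ y in a..u.2, K' u.1 y :=
    intervalIntegral.continuous_parametric_primitive_of_continuous hK'
  refine contDiff_one_iff_hasFDerivAt.2 ⟨_, ?_, fun u =>
    (hasStrictFDerivAt_primitive_param hK hK' h a u).hasFDerivAt⟩
  have h1 := (ContinuousLinearMap.toSpanSingletonCLE (𝕜 := ℝ) (E := E)).continuous.comp hc
  have h2 := (ContinuousLinearMap.toSpanSingletonCLE (𝕜 := ℝ) (E := E)).continuous.comp hK
  exact h1.continuousLinearMapCoprod h2

/-- Leibniz' rule along a curve. -/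
theorem hasDerivAt_primitive_param {K K' : ℝ → ℝ → E}
    (hK : Continuous (Function.uncurry K)) (hK' : Continuous (Function.uncurry K'))
    (h : ∀ s y, HasDerivAt (fun s => K s y) (K' s y) s) (a : ℝ) {σ ξ : ℝ → ℝ} {σ' ξ' r : ℝ}
    (hσ : HasDerivAt σ σ' r) (hξ : HasDerivAt ξ ξ' r) :
    HasDerivAt (fun r => ∫ y in a..ξ r, K (σ r) y)
      (σ' • (∫ y in a..ξ r, K' (σ r) y) + ξ' • K (σ r) (ξ r)) r := by
  refine ((hasStrictFDerivAt_primitive_param hK hK' h a (σ r, ξ r)).hasFDerivAt.comp_hasDerivAt r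
    (hσ.prodMk hξ)).congr_deriv ?_
  simp

/-- The derivative of a convolution on the half-line. -/
theorem hasDerivAt_intervalIntegral_convolution {f k k' : ℝ → ℂ} (hf : Continuous f)
    (hk' : Continuous k') (h : ∀ t, HasDerivAt k (k' t) t) (t : ℝ) :
    HasDerivAt (fun t => ∫ s in (0 : ℝ)..t, f s * k (t - s))
      (f t * k 0 + ∫ s in (0 : ℝ)..t, f s * k' (t - s)) t := by
  have hk : Continuous k := continuous_iff_continuousAt.2 fun t => (h t).continuousAt
  refine (hasDerivAt_primitive_param (K := fun t s => f s * k (t - s))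
    (K' := fun t s => f s * k' (t - s)) (by fun_prop) (by fun_prop)
    (fun t s => ((h (t - s)).comp_sub_const t s).const_mul _) 0 (hasDerivAt_id t)
    (hasDerivAt_id t)).congr_deriv ?_
  simp [add_comm]

open BoundedContinuousFunction in
/-- Global solutions of an initial value problem with a globally Lipschitz right-hand side. -/
theorem exists_forall_hasDerivAt_of_lipschitz {F : ℝ → E → E} {K : ℝ} (hK : 0 < K)
    (hF : Continuous (Function.uncurry F)) (hF0 : ∀ t, F t 0 = 0)
    (hL : ∀ t x y, ‖F t x - F t y‖ ≤ K * ‖x - y‖) (y₀ : E) :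
    ∃ y : ℝ → E, y 0 = y₀ ∧ ∀ t, HasDerivAt y (F t (y t)) t := by
  set L := 2 * K with hLdef
  have hLpos : 0 < L := by positivity
  have hcont : ∀ φ : ℝ →ᵇ E, Continuous fun s => F s (Real.exp (L * |s|) • φ s) := fun φ => by
    have : Continuous fun s => (s, Real.exp (L * |s|) • φ s) := by fun_prop
    exact hF.comp this
  have hdiff : ∀ (φ ψ : ℝ → E) (C : ℝ), 
      (∀ s, ‖φ s - ψ s‖ ≤ C) → ∀ t, ‖∫ s in (0 : ℝ)..t, (F s (Real.exp (L * |s|) • φ s) -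
        F s (Real.exp (L * |s|) • ψ s))‖ ≤ C / 2 * Real.exp (L * |t|) := by
    intro φ ψ C hC t
    have hC0 : 0 ≤ C := (norm_nonneg _).trans (hC 0)
    have := norm_integral_le_of_exp_growth (f := fun s => F s (Real.exp (L * |s|) • φ s) -
        F s (Real.exp (L * |s|) • ψ s)) (D := K * C) (c := 0) (d := t) hLpos (fun s _ => by
      refine (hL _ _ _).trans ?_
      rw [← smul_sub, norm_smul, Real.norm_of_nonneg (Real.exp_pos _).le, sub_zero, mul_assoc,
        mul_comm (Real.exp _)]
      rw [mul_assoc K C]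
      exact mul_le_mul_of_nonneg_left (mul_le_mul_of_nonneg_right (hC s) (Real.exp_pos _).le) hK.le)
    refine this.trans ?_
    rw [sub_zero, hLdef, show K * C / (2 * K) = C / 2 by field_simp]
    gcongr
    linarith
  have hb : ∀ φ : ℝ →ᵇ E, ∀ t, ‖Real.exp (-(L * |t|)) • (y₀ + ∫ s in (0 : ℝ)..t,
      F s (Real.exp (L * |s|) • φ s))‖ ≤ ‖y₀‖ + ‖φ‖ / 2 := by
    intro φ t
    have h1 := hdiff φ 0 ‖φ‖ (fun s => by simpa using φ.norm_coe_le_norm s) t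
    simp only [Pi.zero_apply, smul_zero, hF0, sub_zero] at h1
    rw [norm_smul, Real.norm_of_nonneg (Real.exp_pos _).le]
    calc _ ≤ Real.exp (-(L * |t|)) * (‖y₀‖ + ‖φ‖ / 2 * Real.exp (L * |t|)) := by
          gcongr
          exact (norm_add_le _ _).trans (by gcongr)
      _ = Real.exp (-(L * |t|)) * ‖y₀‖ + ‖φ‖ / 2 * (Real.exp (-(L * |t|)) * Real.exp (L * |t|)) := by
          ring
      _ ≤ 1 * ‖y₀‖ + ‖φ‖ / 2 * 1 := by
          rw [← Real.exp_add]
          gcongr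
          · exact Real.exp_le_one_iff.2 (by simp; positivity)
          · simp
      _ = _ := by ring
  let T : (ℝ →ᵇ E) → (ℝ →ᵇ E) := fun φ => BoundedContinuousFunction.ofNormedAddCommGroup
    (fun t => Real.exp (-(L * |t|)) • (y₀ + ∫ s in (0 : ℝ)..t, F s (Real.exp (L * |s|) • φ s)))
    (by
      have := intervalIntegral.continuous_primitive (μ := volume)
        (fun a b => (hcont φ).intervalIntegrable a b) 0
      fun_prop) _ (hb φ)
  have hT : ContractingWith (1 / 2) T := by
    refine ⟨by norm_num, LipschitzWith.of_dist_le_mul fun φ ψ => ?_⟩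
    rw [BoundedContinuousFunction.dist_le (by positivity)]
    intro t
    have h1 := hdiff φ ψ (dist φ ψ) (fun s => by
      rw [← dist_eq_norm]; exact dist_coe_le_dist s) t
    rw [intervalIntegral.integral_sub ((hcont φ).intervalIntegrable _ _)
      ((hcont ψ).intervalIntegrable _ _)] at h1
    rw [dist_eq_norm]
    simp only [T, coe_ofNormedAddCommGroup]
    rw [← smul_sub, add_sub_add_left_eq_sub, norm_smul, Real.norm_of_nonneg (Real.exp_pos _).le]
    calc _ ≤ Real.exp (-(L * |t|)) * (dist φ ψ / 2 * Real.exp (L * |t|)) := by gcongr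
      _ = (1 / 2) * dist φ ψ * (Real.exp (-(L * |t|)) * Real.exp (L * |t|)) := by ring
      _ = _ := by rw [← Real.exp_add]; simp
  obtain ⟨φ, hφ, -⟩ := hT.exists_fixedPoint 0 (edist_ne_top _ _)
  have hfix : ∀ t, Real.exp (L * |t|) • φ t = y₀ + ∫ s in (0 : ℝ)..t,
      F s (Real.exp (L * |s|) • φ s) := by
    intro t
    have : φ t = Real.exp (-(L * |t|)) • (y₀ + ∫ s in (0 : ℝ)..t,
      F s (Real.exp (L * |s|) • φ s)) := by
      conv_lhs => rw [← hφ]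
      rfl
    rw [this, smul_smul, ← Real.exp_add, add_neg_cancel, Real.exp_zero, one_smul]
  refine ⟨fun t => Real.exp (L * |t|) • φ t, by simpa using hfix 0, fun t => ?_⟩
  exact (((hcont φ).integral_hasStrictDerivAt 0 t).hasDerivAt.const_add y₀).congr_of_eventuallyEq
    (.of_forall hfix)

end Calculus

noncomputable section

/-! ### The impulse response of the Dirac system -/

section Kernel

open Function ComplexConjugate

/-- The left-moving wave generated by the right-moving wave `b`. In both waves the second argument
is the delay `t - x`. -/
def reflectedWave (w : ℝ → ℂ) (b : ℝ → ℝ → ℂ) (x τ : ℝ) : ℂ :=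
  ∫ y in x..x + τ / 2, I * w y * b y (2 * (x - y) + τ)

/-- The right-moving wave generated by the left-moving wave `a`, which is reflected at `0`. -/
def transmittedWave (w : ℝ → ℂ) (a : ℝ → ℝ → ℂ) (x τ : ℝ) : ℂ :=
  -a 0 τ + ∫ y in (0 : ℝ)..x, I * conj (w y) * a y τ

variable {w : ℝ → ℂ} {a b : ℝ → ℝ → ℂ} {M κ C : ℝ}

@[fun_prop]
theorem continuous_conj_comp (hw : Continuous w) : Continuous fun y => conj (w y) :=
  continuous_conj.comp hw

theorem reflectedWave_eq_sub (hw : Continuous w) (hb : Continuous (uncurry b)) (x τ : ℝ) :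
    reflectedWave w b x τ = (∫ y in (0 : ℝ)..x + τ / 2, I * w y * b y (2 * x + τ - 2 * y)) -
      ∫ y in (0 : ℝ)..x, I * w y * b y (2 * x + τ - 2 * y) := by
  have hc : Continuous fun y => I * w y * b y (2 * x + τ - 2 * y) := by
    have : Continuous fun y => uncurry b (y, 2 * x + τ - 2 * y) := by fun_prop
    exact (continuous_const.mul hw).mul this
  rw [intervalIntegral.integral_interval_sub_left (hc.intervalIntegrable _ _)
    (hc.intervalIntegrable _ _)]
  refine intervalIntegral.integral_congr fun y _ => ?_
  ring_nf

theorem continuous_reflectedWave (hw : Continuous w) (hb : Continuous (uncurry b)) :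
    Continuous (uncurry (reflectedWave w b)) := by
  have hK : Continuous (uncurry fun (u : ℝ × ℝ) y => I * w y * b y (2 * u.1 + u.2 - 2 * y)) := by
    have : Continuous fun q : (ℝ × ℝ) × ℝ =>
      uncurry b (q.2, 2 * q.1.1 + q.1.2 - 2 * q.2) := by fun_prop
    exact (continuous_const.mul (hw.comp continuous_snd)).mul this
  have h1 := intervalIntegral.continuous_parametric_intervalIntegral_of_continuous
    (μ := volume) (a₀ := 0) hK (s := fun u => u.1 + u.2 / 2) (by fun_prop)
  have h2 := intervalIntegral.continuous_parametric_intervalIntegral_of_continuous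
    (μ := volume) (a₀ := 0) hK (s := fun u => u.1) (by fun_prop)
  exact (h1.sub h2).congr fun u => (reflectedWave_eq_sub hw hb u.1 u.2).symm

theorem continuous_transmittedWave (hw : Continuous w) (ha : Continuous (uncurry a)) :
    Continuous (uncurry (transmittedWave w a)) := by
  have hK : Continuous (uncurry fun (u : ℝ × ℝ) y => I * conj (w y) * a y u.2) := by
    have : Continuous fun q : (ℝ × ℝ) × ℝ => uncurry a (q.2, q.1.2) := by fun_prop
    exact (continuous_const.mul ((continuous_conj.comp hw).comp continuous_snd)).mul this
  have h1 := intervalIntegral.continuous_parametric_intervalIntegral_of_continuous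
    (μ := volume) (a₀ := 0) hK (s := fun u => u.1) (by fun_prop)
  have h2 : Continuous fun u : ℝ × ℝ => uncurry a (0, u.2) := by fun_prop
  exact h2.neg.add h1

theorem reflectedWave_sub (hw : Continuous w) {b b' : ℝ → ℝ → ℂ} (hb : Continuous (uncurry b))
    (hb' : Continuous (uncurry b')) (x τ : ℝ) :
    reflectedWave w (fun x τ => b x τ - b' x τ) x τ =
      reflectedWave w b x τ - reflectedWave w b' x τ := by
  have h1 : Continuous fun y => uncurry b (y, 2 * (x - y) + τ) := by fun_prop
  have h2 : Continuous fun y => uncurry b' (y, 2 * (x - y) + τ) := by fun_prop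
  simp only [reflectedWave]
  rw [← intervalIntegral.integral_sub]
  · simp only [mul_sub]
  · exact ((continuous_const.mul hw).mul h1).intervalIntegrable _ _
  · exact ((continuous_const.mul hw).mul h2).intervalIntegrable _ _

theorem transmittedWave_sub (hw : Continuous w) {a a' : ℝ → ℝ → ℂ} (ha : Continuous (uncurry a))
    (ha' : Continuous (uncurry a')) (x τ : ℝ) :
    transmittedWave w (fun x τ => a x τ - a' x τ) x τ =
      transmittedWave w a x τ - transmittedWave w a' x τ := by
  have h1 : Continuous fun y => uncurry a (y, τ) := by fun_prop
  have h2 : Continuous fun y => uncurry a' (y, τ) := by fun_prop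
  have h3 : (∫ y in (0 : ℝ)..x, I * conj (w y) * (a y τ - a' y τ)) =
      (∫ y in (0 : ℝ)..x, I * conj (w y) * a y τ) - ∫ y in (0 : ℝ)..x, I * conj (w y) * a' y τ := by
    rw [← intervalIntegral.integral_sub]
    · simp only [mul_sub]
    · exact ((continuous_const.mul (continuous_conj_comp hw)).mul h1).intervalIntegrable _ _
    · exact ((continuous_const.mul (continuous_conj_comp hw)).mul h2).intervalIntegrable _ _
  simp only [transmittedWave]
  rw [h3]
  ring

theorem norm_reflectedWave_le (hM : ∀ x, ‖w x‖ ≤ M) (hκ : 0 < κ)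
    (hb : ∀ x τ, ‖b x τ‖ ≤ C * Real.exp (κ * (|x| + |τ|))) (x τ : ℝ) :
    ‖reflectedWave w b x τ‖ ≤ M / κ * C * Real.exp (κ * (|x| + |τ|)) := by
  have hM0 : 0 ≤ M := (norm_nonneg _).trans (hM 0)
  have hC0 : 0 ≤ C := by
    have := (norm_nonneg _).trans (hb 0 0)
    simpa using this
  refine (norm_integral_le_of_exp_decay (D := M * (C * Real.exp (κ * (|x| + |τ|)))) hκ
    (by positivity) fun y hy => ?_).trans_eq (by ring)
  rw [norm_mul, norm_mul, norm_I, one_mul, mul_assoc, mul_assoc, ← Real.exp_add]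
  refine mul_le_mul (hM y) ((hb _ _).trans ?_) (norm_nonneg _) hM0
  gcongr
  have h1 : |y| ≤ |x| + |y - x| := by simpa using abs_add_le x (y - x)
  have h2 : |2 * (x - y) + τ| + 2 * |y - x| = |τ| := by
    rcases le_total 0 τ with h | h
    · rw [uIcc_of_le (by linarith)] at hy
      rw [abs_of_nonneg h, abs_of_nonneg (by linarith [hy.1] : 0 ≤ y - x),
        abs_of_nonneg (by linarith [hy.2])]
      ring
    · rw [uIcc_of_ge (by linarith)] at hy
      rw [abs_of_nonpos h, abs_of_nonpos (by linarith [hy.2] : y - x ≤ 0),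
        abs_of_nonpos (by linarith [hy.1])]
      ring
  nlinarith

theorem norm_transmittedWave_le (hM : ∀ x, ‖w x‖ ≤ M) (hκ : 0 < κ) (hMκ : M ≤ κ)
    (ha : ∀ x τ, ‖a x τ‖ ≤ C * Real.exp (κ * (|x| + |τ|))) (x τ : ℝ) :
    ‖transmittedWave w a x τ‖ ≤ C * Real.exp (κ * (|x| + |τ|)) := by
  have hM0 : 0 ≤ M := (norm_nonneg _).trans (hM 0)
  have hC0 : 0 ≤ C := by
    have := (norm_nonneg _).trans (ha 0 0)
    simpa using this
  have h1 := norm_integral_le_of_exp_growth (f := fun y => I * conj (w y) * a y τ)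
    (D := M * (C * Real.exp (κ * |τ|))) (c := 0) (d := x) hκ fun y _ => by
      rw [norm_mul, norm_mul, norm_I, one_mul, RCLike.norm_conj, mul_assoc, mul_assoc,
        ← Real.exp_add]
      refine mul_le_mul (hM y) ((ha _ _).trans_eq ?_) (norm_nonneg _) hM0
      rw [sub_zero]
      ring_nf
  have h2 : ‖a 0 τ‖ ≤ C * Real.exp (κ * |τ|) := by simpa using ha 0 τ
  have h3 : M * (C * Real.exp (κ * |τ|)) / κ = M / κ * (C * Real.exp (κ * |τ|)) := by ring
  have h4 : M / κ ≤ 1 := (div_le_one hκ).2 hMκ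
  have h5 : (0 : ℝ) ≤ Real.exp (κ * |x|) - 1 := by
    rw [sub_nonneg]; exact Real.one_le_exp (by positivity)
  calc ‖transmittedWave w a x τ‖ ≤ ‖-a 0 τ‖ + _ := norm_add_le _ _
    _ ≤ C * Real.exp (κ * |τ|) + M / κ * (C * Real.exp (κ * |τ|)) * (Real.exp (κ * |x|) - 1) := by
        rw [norm_neg, ← h3]
        gcongr
        simpa using h1
    _ ≤ C * Real.exp (κ * |τ|) + 1 * (C * Real.exp (κ * |τ|)) * (Real.exp (κ * |x|) - 1) := by
        gcongr
    _ = C * (Real.exp (κ * |x|) * Real.exp (κ * |τ|)) := by ring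
    _ = _ := by rw [← Real.exp_add]; ring_nf

open BoundedContinuousFunction in
/-- The regular parts `a` and `b` of the left-moving and of the right-moving wave generated by an
impulse at the boundary. -/
theorem exists_impulseResponse (hw : Continuous w) (hM : ∀ x, ‖w x‖ ≤ M) (hMκ : M < κ) :
    ∃ a b : ℝ → ℝ → ℂ, ∃ C : ℝ, Continuous (uncurry a) ∧ Continuous (uncurry b) ∧
      (∀ x τ, ‖a x τ‖ ≤ C * Real.exp (κ * (|x| + |τ|))) ∧
      (∀ x τ, ‖b x τ‖ ≤ C * Real.exp (κ * (|x| + |τ|))) ∧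
      (∀ x τ, a x τ = I * w (x + τ / 2) + reflectedWave w b x τ) ∧
      ∀ x τ, b x τ = transmittedWave w a x τ := by
  have hM0 : 0 ≤ M := (norm_nonneg _).trans (hM 0)
  have hκ : 0 < κ := hM0.trans_lt hMκ
  let A : ((ℝ × ℝ) →ᵇ ℂ) → ℝ → ℝ → ℂ := fun φ x τ => Real.exp (κ * (|x| + |τ|)) * φ (x, τ)
  have hA : ∀ φ, Continuous (uncurry (A φ)) := fun φ => by
    have : Continuous fun u : ℝ × ℝ => (Real.exp (κ * (|u.1| + |u.2|)) : ℂ) * φ u := by fun_prop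
    exact this
  have hAn : ∀ φ x τ, ‖A φ x τ‖ ≤ ‖φ‖ * Real.exp (κ * (|x| + |τ|)) := fun φ x τ => by
    simp only [A]
    rw [norm_mul, Complex.norm_real, Real.norm_of_nonneg (Real.exp_pos _).le, mul_comm]
    gcongr
    exact φ.norm_coe_le_norm _
  let R : (ℝ → ℝ → ℂ) → ℝ → ℝ → ℂ := fun a => reflectedWave w (transmittedWave w a)
  have hR : ∀ φ, Continuous (uncurry (R (A φ))) := fun φ =>
    continuous_reflectedWave hw (continuous_transmittedWave hw (hA φ))
  have hRn : ∀ (a : ℝ → ℝ → ℂ) (C : ℝ), (∀ x τ, ‖a x τ‖ ≤ C * Real.exp (κ * (|x| + |τ|))) →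
      ∀ x τ, ‖R a x τ‖ ≤ M / κ * C * Real.exp (κ * (|x| + |τ|)) := fun a C ha =>
    norm_reflectedWave_le hM hκ (norm_transmittedWave_le hM hκ hMκ.le ha)
  have hexp : ∀ u : ℝ × ℝ, ‖(Real.exp (-(κ * (|u.1| + |u.2|))) : ℂ)‖ =
      Real.exp (-(κ * (|u.1| + |u.2|))) := fun u => by
    rw [Complex.norm_real, Real.norm_of_nonneg (Real.exp_pos _).le]
  have hcancel : ∀ r : ℝ, Real.exp (-r) * Real.exp r = 1 := fun r => by
    rw [← Real.exp_add]; simp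
  let T : ((ℝ × ℝ) →ᵇ ℂ) → ((ℝ × ℝ) →ᵇ ℂ) := fun φ =>
    BoundedContinuousFunction.ofNormedAddCommGroup
      (fun u => (Real.exp (-(κ * (|u.1| + |u.2|))) : ℂ) *
        (I * w (u.1 + u.2 / 2) + R (A φ) u.1 u.2))
      (by
        have h1 : Continuous fun u : ℝ × ℝ => R (A φ) u.1 u.2 := hR φ
        fun_prop) (M + M / κ * ‖φ‖) (fun u => by
        rw [norm_mul, hexp]
        have h1 : ‖I * w (u.1 + u.2 / 2) + R (A φ) u.1 u.2‖ ≤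
            M + M / κ * ‖φ‖ * Real.exp (κ * (|u.1| + |u.2|)) := by
          refine (norm_add_le _ _).trans (add_le_add ?_ (hRn _ _ (hAn φ) _ _))
          rw [norm_mul, norm_I, one_mul]
          exact hM _
        calc _ ≤ Real.exp (-(κ * (|u.1| + |u.2|))) *
              (M + M / κ * ‖φ‖ * Real.exp (κ * (|u.1| + |u.2|))) := by gcongr
          _ = Real.exp (-(κ * (|u.1| + |u.2|))) * M + M / κ * ‖φ‖ *
              (Real.exp (-(κ * (|u.1| + |u.2|))) * Real.exp (κ * (|u.1| + |u.2|))) := by ring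
          _ ≤ 1 * M + M / κ * ‖φ‖ * 1 := by
              rw [hcancel]
              gcongr
              exact Real.exp_le_one_iff.2 (by simp; positivity)
          _ = _ := by ring)
  have hT : ContractingWith (M / κ).toNNReal T := by
    refine ⟨by rw [Real.toNNReal_lt_one]; exact (div_lt_one hκ).2 hMκ,
      LipschitzWith.of_dist_le_mul fun φ ψ => ?_⟩
    rw [Real.coe_toNNReal _ (by positivity), BoundedContinuousFunction.dist_le (by positivity)]
    intro u
    have h1 : R (A φ) u.1 u.2 - R (A ψ) u.1 u.2 = R (A (φ - ψ)) u.1 u.2 := by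
      simp only [R]
      rw [← reflectedWave_sub hw (continuous_transmittedWave hw (hA φ))
        (continuous_transmittedWave hw (hA ψ))]
      congr 1
      funext x τ
      rw [← transmittedWave_sub hw (hA φ) (hA ψ)]
      congr 1
      funext x τ
      simp [A, mul_sub]
    have h2 := hRn _ _ (hAn (φ - ψ)) u.1 u.2
    rw [dist_eq_norm]
    simp only [T, coe_ofNormedAddCommGroup]
    rw [← mul_sub, add_sub_add_left_eq_sub, h1, norm_mul, hexp]
    calc _ ≤ Real.exp (-(κ * (|u.1| + |u.2|))) *
          (M / κ * ‖φ - ψ‖ * Real.exp (κ * (|u.1| + |u.2|))) := by gcongr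
      _ = M / κ * ‖φ - ψ‖ *
          (Real.exp (-(κ * (|u.1| + |u.2|))) * Real.exp (κ * (|u.1| + |u.2|))) := by ring
      _ = _ := by rw [hcancel, mul_one, dist_eq_norm]
  obtain ⟨φ, hφ, -⟩ := hT.exists_fixedPoint 0 (edist_ne_top _ _)
  refine ⟨A φ, transmittedWave w (A φ), ‖φ‖, hA φ, continuous_transmittedWave hw (hA φ), hAn φ,
    norm_transmittedWave_le hM hκ hMκ.le (hAn φ), fun x τ => ?_, fun _ _ => rfl⟩
  have h1 : φ (x, τ) = (Real.exp (-(κ * (|x| + |τ|))) : ℂ) *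
      (I * w (x + τ / 2) + R (A φ) x τ) := by
    conv_lhs => rw [← hφ]
    rfl
  have h2 : (Real.exp (κ * (|x| + |τ|)) : ℂ) * (Real.exp (-(κ * (|x| + |τ|))) : ℂ) = 1 := by
    rw [← ofReal_mul, mul_comm, hcancel, ofReal_one]
  calc A φ x τ = (Real.exp (κ * (|x| + |τ|)) : ℂ) * φ (x, τ) := rfl
    _ = _ := by rw [h1, ← mul_assoc, h2, one_mul]

end Kernel

/-! ### A classical solution of the dynamical system -/

section ClassicalSolution

open Function ComplexConjugate

variable {w : ℝ → ℂ} {a a' b b' : ℝ → ℝ → ℂ}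

theorem hasDerivAt_reflectedWave (hw : Continuous w) (hb : Continuous (uncurry b))
    (hb' : Continuous (uncurry b')) (h : ∀ x τ, HasDerivAt (b x) (b' x τ) τ)
    {X S : ℝ → ℝ} {X' S' r : ℝ} (hX : HasDerivAt X X' r) (hS : HasDerivAt S S' r) :
    HasDerivAt (fun r => reflectedWave w b (X r) (S r))
      ((2 * X' + S') * reflectedWave w b' (X r) (S r) +
        (X' + S' / 2) * (I * w (X r + S r / 2) * b (X r + S r / 2) 0) -
        X' * (I * w (X r) * b (X r) (S r))) r := by
  have hK : Continuous (uncurry fun s y => I * w y * b y (s - 2 * y)) := by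
    have : Continuous fun u : ℝ × ℝ => uncurry b (u.2, u.1 - 2 * u.2) := by fun_prop
    exact (continuous_const.mul (hw.comp continuous_snd)).mul this
  have hK' : Continuous (uncurry fun s y => I * w y * b' y (s - 2 * y)) := by
    have : Continuous fun u : ℝ × ℝ => uncurry b' (u.2, u.1 - 2 * u.2) := by fun_prop
    exact (continuous_const.mul (hw.comp continuous_snd)).mul this
  have hd : ∀ s y, HasDerivAt (fun s => I * w y * b y (s - 2 * y)) (I * w y * b' y (s - 2 * y)) s :=
    fun s y => ((h y (s - 2 * y)).comp_sub_const s (2 * y)).const_mul _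
  have h1 := hasDerivAt_primitive_param hK hK' hd 0 ((hX.const_mul 2).add hS)
    (hX.add (hS.div_const 2))
  have h2 := hasDerivAt_primitive_param hK hK' hd 0 ((hX.const_mul 2).add hS) hX
  refine ((h1.sub h2).congr_of_eventuallyEq (.of_forall fun r => ?_)).congr_deriv ?_
  · exact reflectedWave_eq_sub hw hb _ _
  · rw [reflectedWave_eq_sub hw hb']
    simp only [Pi.add_apply, real_smul]
    push_cast
    ring_nf

theorem contDiff_reflectedWave (hw : Continuous w) (hb : Continuous (uncurry b))
    (hb' : Continuous (uncurry b')) (h : ∀ x τ, HasDerivAt (b x) (b' x τ) τ) :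
    ContDiff ℝ 1 (uncurry (reflectedWave w b)) := by
  have hK : Continuous (uncurry fun s y => I * w y * b y (s - 2 * y)) := by
    have : Continuous fun u : ℝ × ℝ => uncurry b (u.2, u.1 - 2 * u.2) := by fun_prop
    exact (continuous_const.mul (hw.comp continuous_snd)).mul this
  have hK' : Continuous (uncurry fun s y => I * w y * b' y (s - 2 * y)) := by
    have : Continuous fun u : ℝ × ℝ => uncurry b' (u.2, u.1 - 2 * u.2) := by fun_prop
    exact (continuous_const.mul (hw.comp continuous_snd)).mul this
  have hd : ∀ s y, HasDerivAt (fun s => I * w y * b y (s - 2 * y)) (I * w y * b' y (s - 2 * y)) s :=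
    fun s y => ((h y (s - 2 * y)).comp_sub_const s (2 * y)).const_mul _
  have hG := contDiff_primitive_param hK hK' hd 0
  have h1 : ContDiff ℝ 1 fun u : ℝ × ℝ => (2 * u.1 + u.2, u.1 + u.2 / 2) := by fun_prop
  have h2 : ContDiff ℝ 1 fun u : ℝ × ℝ => (2 * u.1 + u.2, u.1) := by fun_prop
  convert! (hG.comp h1).sub (hG.comp h2) using 1
  funext u
  exact reflectedWave_eq_sub hw hb _ _

theorem hasDerivAt_transmittedWave (hw : Continuous w) (ha : Continuous (uncurry a))
    (ha' : Continuous (uncurry a')) (h : ∀ x τ, HasDerivAt (a x) (a' x τ) τ)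
    {X S : ℝ → ℝ} {X' S' r : ℝ} (hX : HasDerivAt X X' r) (hS : HasDerivAt S S' r) :
    HasDerivAt (fun r => transmittedWave w a (X r) (S r))
      (S' * transmittedWave w a' (X r) (S r) + X' * (I * conj (w (X r)) * a (X r) (S r))) r := by
  have hK : Continuous (uncurry fun s y => I * conj (w y) * a y s) := by
    have : Continuous fun u : ℝ × ℝ => uncurry a (u.2, u.1) := by fun_prop
    exact (continuous_const.mul ((continuous_conj_comp hw).comp continuous_snd)).mul this
  have hK' : Continuous (uncurry fun s y => I * conj (w y) * a' y s) := by
    have : Continuous fun u : ℝ × ℝ => uncurry a' (u.2, u.1) := by fun_prop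
    exact (continuous_const.mul ((continuous_conj_comp hw).comp continuous_snd)).mul this
  have hd : ∀ s y, HasDerivAt (fun s => I * conj (w y) * a y s) (I * conj (w y) * a' y s) s :=
    fun s y => (h y s).const_mul _
  have h1 := hasDerivAt_primitive_param hK hK' hd 0 hS hX
  have h2 := (h 0 (S r)).scomp r hS
  refine (h2.neg.add h1).congr_deriv ?_
  simp only [transmittedWave, real_smul]
  ring

theorem contDiff_transmittedWave (hw : Continuous w) (ha : Continuous (uncurry a))
    (ha' : Continuous (uncurry a')) (h : ∀ x τ, HasDerivAt (a x) (a' x τ) τ) :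
    ContDiff ℝ 1 (uncurry (transmittedWave w a)) := by
  have hK : Continuous (uncurry fun s y => I * conj (w y) * a y s) := by
    have : Continuous fun u : ℝ × ℝ => uncurry a (u.2, u.1) := by fun_prop
    exact (continuous_const.mul ((continuous_conj_comp hw).comp continuous_snd)).mul this
  have hK' : Continuous (uncurry fun s y => I * conj (w y) * a' y s) := by
    have : Continuous fun u : ℝ × ℝ => uncurry a' (u.2, u.1) := by fun_prop
    exact (continuous_const.mul ((continuous_conj_comp hw).comp continuous_snd)).mul this
  have hd : ∀ s y, HasDerivAt (fun s => I * conj (w y) * a y s) (I * conj (w y) * a' y s) s :=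
    fun s y => (h y s).const_mul _
  have hG := contDiff_primitive_param hK hK' hd 0
  have h0 : ContDiff ℝ 1 (a 0) := by
    rw [contDiff_one_iff_deriv]
    refine ⟨fun τ => (h 0 τ).differentiableAt, ?_⟩
    rw [show deriv (a 0) = a' 0 from funext fun τ => (h 0 τ).deriv]
    exact ha'.uncurry_left 0
  have h1 : ContDiff ℝ 1 fun u : ℝ × ℝ => (u.2, u.1) := by fun_prop
  exact (h0.comp contDiff_snd).neg.add (hG.comp h1)

/-- The primitive in the second variable. -/
def primitiveSnd (a : ℝ → ℝ → ℂ) (x τ : ℝ) : ℂ := ∫ s in (0 : ℝ)..τ, a x s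

@[simp]
theorem primitiveSnd_zero (x : ℝ) : primitiveSnd a x 0 = 0 := by simp [primitiveSnd]

theorem continuous_primitiveSnd (ha : Continuous (uncurry a)) :
    Continuous (uncurry (primitiveSnd a)) :=
  intervalIntegral.continuous_parametric_primitive_of_continuous ha

theorem hasDerivAt_primitiveSnd (ha : Continuous (uncurry a)) (x τ : ℝ) :
    HasDerivAt (primitiveSnd a x) (a x τ) τ :=
  ((ha.uncurry_left x).integral_hasStrictDerivAt 0 τ).hasDerivAt

theorem primitiveSnd_eq (ha : Continuous (uncurry a)) {F : ℝ → ℝ → ℂ} (hF0 : ∀ x, F x 0 = 0)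
    (hF : ∀ x τ, HasDerivAt (F x) (a x τ) τ) : primitiveSnd a = F := by
  funext x τ
  rw [primitiveSnd, intervalIntegral.integral_eq_sub_of_hasDerivAt (fun s _ => hF x s)
    ((ha.uncurry_left x).intervalIntegrable _ _), hF0, sub_zero]

theorem primitiveSnd_transmittedWave (hw : Continuous w) (ha : Continuous (uncurry a)) :
    primitiveSnd (transmittedWave w a) = transmittedWave w (primitiveSnd a) := by
  refine primitiveSnd_eq (continuous_transmittedWave hw ha) (fun x => by simp [transmittedWave])
    fun x τ => ?_
  refine (hasDerivAt_transmittedWave hw (continuous_primitiveSnd ha) ha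
    (hasDerivAt_primitiveSnd ha) (hasDerivAt_const τ x) (hasDerivAt_id τ)).congr_deriv ?_
  simp

theorem primitiveSnd_reflectedWave (hw : Continuous w) (ha : Continuous (uncurry a))
    (hb : Continuous (uncurry b)) (hb' : Continuous (uncurry b'))
    (h : ∀ x τ, HasDerivAt (b x) (b' x τ) τ)
    (hab : ∀ x τ, a x τ = I * w (x + τ / 2) * (b (x + τ / 2) 0 / 2) + reflectedWave w b' x τ) :
    primitiveSnd a = reflectedWave w b := by
  refine primitiveSnd_eq ha (fun x => by simp [reflectedWave]) fun x τ => ?_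
  refine (hasDerivAt_reflectedWave hw hb hb' h (hasDerivAt_const τ x)
    (hasDerivAt_id τ)).congr_deriv ?_
  rw [hab]
  simp
  ring

/-- Extension by the value at `0` to negative delays. -/
def clampSnd (a : ℝ → ℝ → ℂ) (x τ : ℝ) : ℂ := a x (max τ 0)

theorem continuous_clampSnd (ha : Continuous (uncurry a)) : Continuous (uncurry (clampSnd a)) := by
  have : Continuous fun u : ℝ × ℝ => uncurry a (u.1, max u.2 0) := by fun_prop
  exact this

theorem clampSnd_reflectedWave (hb : ∀ x, b x 0 = 0) :
    clampSnd (reflectedWave w b) = reflectedWave w (clampSnd b) := by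
  funext x τ
  simp only [clampSnd, reflectedWave]
  rcases le_total 0 τ with h | h
  · rw [max_eq_left h]
    refine intervalIntegral.integral_congr fun y hy => ?_
    rw [uIcc_of_le (by linarith)] at hy
    rw [max_eq_left (by linarith [hy.2])]
  · rw [max_eq_right h]
    simp only [zero_div, add_zero, intervalIntegral.integral_same]
    rw [intervalIntegral.integral_congr (g := fun _ => 0), intervalIntegral.integral_zero]
    intro y hy
    rw [uIcc_of_ge (by linarith)] at hy
    simp only
    rw [max_eq_right (by linarith [hy.1]), hb, mul_zero]

/-- The control `t ↦ t₊² / 2`. -/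
def quadControl (t : ℝ) : ℂ := ∫ s in (0 : ℝ)..t, ((max s 0 : ℝ) : ℂ)

theorem hasDerivAt_quadControl (t : ℝ) : HasDerivAt quadControl ((max t 0 : ℝ) : ℂ) t :=
  (Continuous.integral_hasStrictDerivAt (by fun_prop) 0 t).hasDerivAt

theorem quadControl_of_nonpos {t : ℝ} (ht : t ≤ 0) : quadControl t = 0 := by
  rw [quadControl, intervalIntegral.integral_congr (g := fun _ => 0), intervalIntegral.integral_zero]
  intro s hs
  rw [uIcc_of_ge ht] at hs
  simp [max_eq_right hs.2]

theorem quadControl_of_nonneg {t : ℝ} (ht : 0 ≤ t) : quadControl t = (t : ℂ) ^ 2 / 2 := by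
  rw [quadControl, intervalIntegral.integral_congr (g := fun s => ((s : ℝ) : ℂ)),
    intervalIntegral.integral_ofReal, integral_id]
  · push_cast; ring
  · intro s hs
    rw [uIcc_of_le ht] at hs
    simp [max_eq_left hs.1]

theorem isControl_quadControl : IsControl quadControl := by
  refine ⟨?_, fun t ht => quadControl_of_nonpos ht⟩
  rw [contDiff_one_iff_deriv]
  refine ⟨fun t => (hasDerivAt_quadControl t).differentiableAt, ?_⟩
  rw [show deriv quadControl = _ from funext fun t => (hasDerivAt_quadControl t).deriv]
  fun_prop

/-- The waves generated by the control `quadControl`. -/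
theorem exists_quadWaves (hw : Continuous w) (ha : Continuous (uncurry a))
    (hb : Continuous (uncurry b))
    (hab : ∀ x τ, a x τ = I * w (x + τ / 2) + reflectedWave w b x τ)
    (hba : ∀ x τ, b x τ = transmittedWave w a x τ) :
    ∃ A A' B B' : ℝ → ℝ → ℂ, Continuous (uncurry A) ∧ Continuous (uncurry A') ∧
      Continuous (uncurry B) ∧ Continuous (uncurry B') ∧
      (∀ x τ, HasDerivAt (A x) (A' x τ) τ) ∧ (∀ x τ, HasDerivAt (B x) (B' x τ) τ) ∧
      (∀ x, ∀ τ ≤ 0, A x τ = 0) ∧ (∀ x, ∀ τ ≤ 0, B x τ = 0) ∧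
      (A = reflectedWave w B) ∧ (∀ x τ, B x τ = 2 * quadControl τ + transmittedWave w A x τ) ∧
      (∀ x τ, B' x τ = 2 * ((max τ 0 : ℝ) : ℂ) + transmittedWave w A' x τ) ∧
      ∀ x τ, 0 ≤ τ → A x τ = primitiveSnd (primitiveSnd (primitiveSnd a)) x τ := by
  obtain rfl : b = transmittedWave w a := funext₂ hba
  set b := transmittedWave w a with hbdef
  set a₁ := primitiveSnd a with ha₁def
  have ha₁ : Continuous (uncurry a₁) := continuous_primitiveSnd ha
  set b₁ : ℝ → ℝ → ℂ := fun x τ => 2 + primitiveSnd b x τ with hb₁def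
  have hb₁ : Continuous (uncurry b₁) := continuous_const.add (continuous_primitiveSnd hb)
  have hb₁' : ∀ x τ, HasDerivAt (b₁ x) (b x τ) τ := fun x τ =>
    (hasDerivAt_primitiveSnd hb x τ).const_add 2
  have hab₁ : a₁ = reflectedWave w b₁ :=
    primitiveSnd_reflectedWave hw ha hb₁ hb hb₁' fun x τ => by rw [hab]; simp [b₁]
  have hba₁ : ∀ x τ, b₁ x τ = 2 + transmittedWave w a₁ x τ := fun x τ => by
    rw [hb₁def, hbdef, primitiveSnd_transmittedWave hw ha]
  set a₂ := primitiveSnd a₁ with ha₂def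
  have ha₂ : Continuous (uncurry a₂) := continuous_primitiveSnd ha₁
  set b₂ := primitiveSnd b₁ with hb₂def
  have hb₂ : Continuous (uncurry b₂) := continuous_primitiveSnd hb₁
  have hab₂ : a₂ = reflectedWave w b₂ :=
    primitiveSnd_reflectedWave hw ha₁ hb₂ hb₁ (hasDerivAt_primitiveSnd hb₁) fun x τ => by
      rw [hab₁]; simp [b₂]
  have hba₂ : ∀ x τ, b₂ x τ = 2 * τ + transmittedWave w a₂ x τ := fun x τ => by
    have h1 : primitiveSnd b₁ = fun x (τ : ℝ) => 2 * (τ : ℂ) + transmittedWave w a₂ x τ := by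
      refine primitiveSnd_eq hb₁ (fun x => ?_) fun x τ => ?_
      · simp [transmittedWave, a₂]
      · rw [hba₁, ha₂def, ← primitiveSnd_transmittedWave hw ha₁]
        refine HasDerivAt.add ?_ (hasDerivAt_primitiveSnd (continuous_transmittedWave hw ha₁) x τ)
        simpa using (ofRealCLM.hasDerivAt (x := τ)).const_mul (2 : ℂ)
    rw [hb₂def, h1]
  set A' := clampSnd a₂ with hA'def
  have hA' : Continuous (uncurry A') := continuous_clampSnd ha₂
  set B' := clampSnd b₂ with hB'def
  have hB' : Continuous (uncurry B') := continuous_clampSnd hb₂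
  have hAB' : A' = reflectedWave w B' := by
    rw [hA'def, hab₂]
    exact clampSnd_reflectedWave fun x => by simp [b₂]
  have hBA' : ∀ x τ, B' x τ = 2 * ((max τ 0 : ℝ) : ℂ) + transmittedWave w A' x τ := fun x τ => by
    simp only [hB'def, clampSnd, hba₂, transmittedWave, hA'def]
  have hzero : ∀ c : ℝ → ℝ → ℂ, (∀ x, c x 0 = 0) → ∀ x, ∀ τ ≤ 0,
      primitiveSnd (clampSnd c) x τ = 0 := fun c hc x τ hτ => by
    rw [primitiveSnd, intervalIntegral.integral_congr (g := fun _ => 0),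
      intervalIntegral.integral_zero]
    intro s hs
    rw [uIcc_of_ge hτ] at hs
    simp [clampSnd, max_eq_right hs.2, hc]
  refine ⟨primitiveSnd A', A', primitiveSnd B', B', continuous_primitiveSnd hA', hA',
    continuous_primitiveSnd hB', hB', hasDerivAt_primitiveSnd hA', hasDerivAt_primitiveSnd hB',
    hzero _ fun x => by simp [a₂], hzero _ fun x => by simp [b₂], ?_, ?_, hBA', ?_⟩
  · refine primitiveSnd_reflectedWave hw hA' (continuous_primitiveSnd hB') hB'
      (hasDerivAt_primitiveSnd hB') fun x τ => ?_
    rw [hAB']; simp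
  · have h1 : primitiveSnd B' = fun x τ => 2 * quadControl τ +
        transmittedWave w (primitiveSnd A') x τ := by
      refine primitiveSnd_eq hB' (fun x => ?_) fun x τ => ?_
      · simp [transmittedWave, quadControl]
      · rw [hBA', ← primitiveSnd_transmittedWave hw hA']
        exact ((hasDerivAt_quadControl τ).const_mul 2).add
          (hasDerivAt_primitiveSnd (continuous_transmittedWave hw hA') x τ)
    intro x τ
    rw [h1]
  · intro x τ hτ
    rw [primitiveSnd, primitiveSnd]
    refine intervalIntegral.integral_congr fun s hs => ?_
    rw [uIcc_of_le hτ] at hs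
    simp [hA'def, clampSnd, max_eq_left hs.1]

/-- The complex potential `p + i q`, extended evenly. -/
def complexPotential (p q : ℝ → ℝ) (x : ℝ) : ℂ := p |x| + I * q |x|

theorem continuous_complexPotential {p q : ℝ → ℝ} (hp : ContinuousOn p (Ici 0))
    (hq : ContinuousOn q (Ici 0)) : Continuous (complexPotential p q) := by
  have h1 : Continuous fun x => p |x| := hp.comp_continuous continuous_abs fun x => abs_nonneg x
  have h2 : Continuous fun x => q |x| := hq.comp_continuous continuous_abs fun x => abs_nonneg x
  exact (continuous_ofReal.comp h1).add (continuous_const.mul (continuous_ofReal.comp h2))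

theorem dynJ_mulVec (v : Fin 2 → ℂ) : dynJ *ᵥ v = ![v 1, -v 0] := by
  ext i
  fin_cases i <;> simp [dynJ, Matrix.mulVec, dotProduct, Fin.sum_univ_two]

theorem dynV_mulVec (p q : ℝ → ℝ) (x : ℝ) (v : Fin 2 → ℂ) :
    dynV p q x *ᵥ v = ![p x * v 0 + q x * v 1, q x * v 0 - p x * v 1] := by
  ext i
  fin_cases i <;> simp [dynV, Matrix.mulVec, dotProduct, Fin.sum_univ_two, sub_eq_add_neg]

theorem exists_isClassicalSolution_quadControl {p q : ℝ → ℝ}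
    (hw : Continuous (complexPotential p q)) (ha : Continuous (uncurry a))
    (hb : Continuous (uncurry b))
    (hab : ∀ x τ, a x τ = I * complexPotential p q (x + τ / 2) +
      reflectedWave (complexPotential p q) b x τ)
    (hba : ∀ x τ, b x τ = transmittedWave (complexPotential p q) a x τ) :
    ∃ U : ℝ → ℝ → Fin 2 → ℂ, IsClassicalSolution p q quadControl U ∧
      (∀ x t, t ≤ x → U x t = 0) ∧
      ∀ t, 0 ≤ t → U 0 t 1 = I * ((t : ℂ) ^ 2 / 2) +
        -I * primitiveSnd (primitiveSnd (primitiveSnd a)) 0 t := by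
  obtain ⟨A, A', B, B', hA, hA', hB, hB', hAd, hBd, hA0, hB0, hAB, hBA, hBA', hAt⟩ :=
    exists_quadWaves hw ha hb hab hba
  set w := complexPotential p q with hwdef
  have hαx : ∀ x t, HasDerivAt (fun x => A x (t - x))
      (A' x (t - x) - I * w x * B x (t - x)) x ∧
      HasDerivAt (fun t => A x (t - x)) (A' x (t - x)) t := by
    intro x t
    have h0 := (hAd x (t - x)).comp_sub_const t x
    refine ⟨?_, h0⟩
    have h1 := hasDerivAt_reflectedWave hw hB hB' hBd (hasDerivAt_const t x)
      ((hasDerivAt_id t).sub_const x)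
    have h2 := hasDerivAt_reflectedWave hw hB hB' hBd (hasDerivAt_id x)
      ((hasDerivAt_id x).const_sub t)
    simp only [← hAB] at h1 h2
    have h3 := h0.unique h1
    refine h2.congr_deriv ?_
    simp only [id, hB0 _ 0 le_rfl] at h3 ⊢
    rw [h3]
    push_cast
    ring
  have hβx : ∀ x t, HasDerivAt (fun x => B x (t - x))
      (-B' x (t - x) + I * conj (w x) * A x (t - x)) x := by
    intro x t
    have h1 := hasDerivAt_transmittedWave hw hA hA' hAd (hasDerivAt_id x)
      ((hasDerivAt_id x).const_sub t)
    have h2 := ((hasDerivAt_quadControl (t - x)).scomp x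
      ((hasDerivAt_id x).const_sub t)).const_mul 2
    refine ((h2.add h1).congr_of_eventuallyEq (.of_forall fun x => hBA _ _)).congr_deriv ?_
    rw [hBA']
    simp
    ring
  have hαC : ContDiff ℝ 1 fun u : ℝ × ℝ => A u.1 (u.2 - u.1) := by
    have h1 := contDiff_reflectedWave hw hB hB' hBd
    have h2 : ContDiff ℝ 1 fun u : ℝ × ℝ => (u.1, u.2 - u.1) := by fun_prop
    rw [← hAB] at h1
    exact h1.comp h2
  have hβC : ContDiff ℝ 1 fun u : ℝ × ℝ => B u.1 (u.2 - u.1) := by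
    have h1 := contDiff_transmittedWave hw hA hA' hAd
    have h2 : ContDiff ℝ 1 fun u : ℝ × ℝ => (u.1, u.2 - u.1) := by fun_prop
    have h3 : ContDiff ℝ 1 fun u : ℝ × ℝ => 2 * quadControl (u.2 - u.1) :=
      contDiff_const.mul (isControl_quadControl.1.comp (by fun_prop))
    convert! h3.add (h1.comp h2) using 1
    funext u
    exact hBA _ _
  have hβ0 : ∀ t, B 0 t = 2 * quadControl t - A 0 t := fun t => by
    rw [hBA]; simp [transmittedWave]; ring
  refine ⟨fun x t => ![(A x (t - x) + B x (t - x)) / 2, -I * (A x (t - x) - B x (t - x)) / 2],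
    ⟨?_, ?_, ?_, ?_⟩, ?_, ?_⟩
  · refine ContDiff.contDiffOn (contDiff_pi.2 fun i => ?_)
    fin_cases i
    · exact (hαC.add hβC).div_const 2
    · exact (contDiff_const.mul (hαC.sub hβC)).div_const 2
  · intro x hx t ht
    have h1 : HasDerivAt (fun s => ![(A x (s - x) + B x (s - x)) / 2,
        -I * (A x (s - x) - B x (s - x)) / 2])
        ![(A' x (t - x) + B' x (t - x)) / 2, -I * (A' x (t - x) - B' x (t - x)) / 2] t := by
      have hβt := (hBd x (t - x)).comp_sub_const t x
      refine hasDerivAt_pi.2 fun i => ?_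
      fin_cases i
      · exact ((hαx x t).2.add hβt).div_const 2
      · exact (((hαx x t).2.sub hβt).const_mul (-I)).div_const 2
    have h2 : HasDerivAt (fun y => ![(A y (t - y) + B y (t - y)) / 2,
        -I * (A y (t - y) - B y (t - y)) / 2])
        ![((A' x (t - x) - I * w x * B x (t - x)) +
          (-B' x (t - x) + I * conj (w x) * A x (t - x))) / 2,
          -I * ((A' x (t - x) - I * w x * B x (t - x)) -
          (-B' x (t - x) + I * conj (w x) * A x (t - x))) / 2] x := by
      refine hasDerivAt_pi.2 fun i => ?_
      fin_cases i
      · exact ((hαx x t).1.add (hβx x t)).div_const 2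
      · exact (((hαx x t).1.sub (hβx x t)).const_mul (-I)).div_const 2
    rw [h1.hasDerivWithinAt.derivWithin (uniqueDiffOn_Ici 0 t ht),
      h2.hasDerivWithinAt.derivWithin (uniqueDiffOn_Ici 0 x hx)]
    have hwx : w x = p x + I * q x := by simp [hwdef, complexPotential, abs_of_nonneg hx]
    have hwc : conj (w x) = p x - I * q x := by
      rw [hwx]; simp [sub_eq_add_neg]
    rw [dynJ_mulVec, dynV_mulVec, hwc, hwx]
    ext i
    fin_cases i
    · simp
      ring_nf
      simp only [I_sq, I_pow_three]
      ring
    · simp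
      ring_nf
      simp only [I_sq]
      ring
  · intro x hx
    ext i
    fin_cases i <;> simp [hA0 x (-x) (by linarith), hB0 x (-x) (by linarith)]
  · intro t ht
    simp [hβ0]
  · intro x t hxt
    ext i
    fin_cases i <;> simp [hA0 x (t - x) (by linarith), hB0 x (t - x) (by linarith)]
  · intro t ht
    simp [hβ0, hAt 0 t ht, quadControl_of_nonneg ht]
    ring

end ClassicalSolution

/-! ### The response function -/

section Response

open Function ComplexConjugate

theorem IsClassicalSolution.exists_hasFDerivAt {p q : ℝ → ℝ} {f : ℝ → ℂ}
    {u : ℝ → ℝ → Fin 2 → ℂ} (hu : IsClassicalSolution p q f u) {x t : ℝ} (hx : 0 < x)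
    (ht : 0 < t) :
    ∃ L : ℝ × ℝ →L[ℝ] (Fin 2 → ℂ), HasFDerivAt (fun y : ℝ × ℝ => u y.1 y.2) L (x, t) ∧
      L (1, 0) 1 = -I * L (0, 1) 0 - (p x * u x t 0 + q x * u x t 1) ∧
      L (1, 0) 0 = I * L (0, 1) 1 + (q x * u x t 0 - p x * u x t 1) := by
  have hd : DifferentiableAt ℝ (fun y : ℝ × ℝ => u y.1 y.2) (x, t) :=
    (hu.contDiffOn.contDiffAt (prod_mem_nhds (Ici_mem_nhds hx) (Ici_mem_nhds ht))).differentiableAt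
      one_ne_zero
  refine ⟨_, hd.hasFDerivAt, ?_⟩
  set L := fderiv ℝ (fun y : ℝ × ℝ => u y.1 y.2) (x, t)
  have h1 : HasDerivAt (fun s => u x s) (L (0, 1)) t :=
    hd.hasFDerivAt.comp_hasDerivAt t ((hasDerivAt_const t x).prodMk (hasDerivAt_id t))
  have h2 : HasDerivAt (fun y => u y t) (L (1, 0)) x :=
    HasFDerivAt.comp_hasDerivAt (f := fun y => (y, t)) x hd.hasFDerivAt
      ((hasDerivAt_id x).prodMk (hasDerivAt_const x t))
  have h3 := hu.equation x hx.le t ht.le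
  rw [h1.hasDerivWithinAt.derivWithin (uniqueDiffOn_Ici 0 t ht.le),
    h2.hasDerivWithinAt.derivWithin (uniqueDiffOn_Ici 0 x hx.le), dynJ_mulVec, dynV_mulVec] at h3
  have e0 : I * L (0, 1) 0 + L (1, 0) 1 + (p x * u x t 0 + q x * u x t 1) = 0 := congrFun h3 0
  have e1 : I * L (0, 1) 1 + -L (1, 0) 0 + (q x * u x t 0 - p x * u x t 1) = 0 := congrFun h3 1
  constructor
  · linear_combination e0
  · linear_combination -e1

/-- Reciprocity of two solutions, one of which vanishes ahead of the wave front. -/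
theorem IsClassicalSolution.reciprocity {p q : ℝ → ℝ} {f g : ℝ → ℂ}
    {u U : ℝ → ℝ → Fin 2 → ℂ} (hu : IsClassicalSolution p q f u)
    (hU : IsClassicalSolution p q g U) (hfront : ∀ x t, t ≤ x → U x t = 0) {T : ℝ} (hT : 0 ≤ T) :
    ∫ s in (0 : ℝ)..T, (f s * U 0 (T - s) 1 - u 0 s 1 * g (T - s)) = 0 := by
  let F : ℝ × ℝ → ℂ := fun y =>
    u y.1 y.2 0 * U y.1 (T - y.2) 1 - u y.1 y.2 1 * U y.1 (T - y.2) 0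
  let G : ℝ × ℝ → ℂ := fun y =>
    -I * (u y.1 y.2 0 * U y.1 (T - y.2) 0 + u y.1 y.2 1 * U y.1 (T - y.2) 1)
  have hc : ∀ i, ContinuousOn (fun y : ℝ × ℝ => u y.1 y.2 i) (uIcc 0 T ×ˢ uIcc 0 T) := fun i => by
    rw [uIcc_of_le hT]
    exact ((continuous_apply i).comp_continuousOn hu.contDiffOn.continuousOn).mono
      (prod_mono Icc_subset_Ici_self Icc_subset_Ici_self)
  have hC : ∀ i, ContinuousOn (fun y : ℝ × ℝ => U y.1 (T - y.2) i) (uIcc 0 T ×ˢ uIcc 0 T) :=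
    fun i => by
    rw [uIcc_of_le hT]
    refine ((continuous_apply i).comp_continuousOn hU.contDiffOn.continuousOn).comp
      (f := fun y : ℝ × ℝ => (y.1, T - y.2)) (by fun_prop) fun y hy => ⟨hy.1.1, ?_⟩
    exact sub_nonneg.2 hy.2.2
  have hF : ContinuousOn F (uIcc 0 T ×ˢ uIcc 0 T) :=
    ((hc 0).mul (hC 1)).sub ((hc 1).mul (hC 0))
  have hG : ContinuousOn G (uIcc 0 T ×ˢ uIcc 0 T) :=
    continuousOn_const.mul (((hc 0).mul (hC 0)).add ((hc 1).mul (hC 1)))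
  have hd : ∀ y ∈ Ioo 0 T ×ˢ Ioo 0 T, HasFDerivAt F (fderiv ℝ F y) y ∧
      HasFDerivAt G (fderiv ℝ G y) y ∧ fderiv ℝ F y (1, 0) + fderiv ℝ G y (0, 1) = 0 := by
    rintro ⟨x, s⟩ ⟨⟨hx0, hxT⟩, hs0, hsT⟩
    obtain ⟨L, hL, l1, l0⟩ := hu.exists_hasFDerivAt hx0 hs0
    obtain ⟨N, hN, n1, n0⟩ := hU.exists_hasFDerivAt hx0 (sub_pos.2 hsT)
    have hL' := hasFDerivAt_pi'.1 hL
    have hN' := hasFDerivAt_pi'.1 (HasFDerivAt.comp (g := fun y : ℝ × ℝ => U y.1 y.2)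
      (f := fun y : ℝ × ℝ => (y.1, T - y.2)) (x, s) hN
      (hasFDerivAt_fst.prodMk (hasFDerivAt_snd.const_sub T)))
    have hFd := ((hL' 0).mul (hN' 1)).sub ((hL' 1).mul (hN' 0))
    have hGd := (((hL' 0).mul (hN' 0)).add ((hL' 1).mul (hN' 1))).const_mul (-I)
    have eF := hFd.fderiv
    have eG := hGd.fderiv
    have hneg : N (0, -1) = -N (0, 1) := by
      rw [← map_neg]; simp
    refine ⟨hFd.differentiableAt.hasFDerivAt, hGd.differentiableAt.hasFDerivAt, ?_⟩
    change fderiv ℝ F (x, s) = _ at eF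
    change fderiv ℝ G (x, s) = _ at eG
    rw [eF, eG]
    simp [hneg, l0, l1, n0, n1]
    ring
  have key := integral2_divergence_prod_of_hasFDerivAt F G
    (fun y => if y ∈ Ioo 0 T ×ˢ Ioo 0 T then fderiv ℝ F y else 0)
    (fun y => if y ∈ Ioo 0 T ×ˢ Ioo 0 T then fderiv ℝ G y else 0) 0 0 T T hF hG
    (by
      rw [min_eq_left hT, max_eq_right hT]
      intro y hy
      rw [if_pos hy]
      exact (hd y hy).1)
    (by
      rw [min_eq_left hT, max_eq_right hT]
      intro y hy
      rw [if_pos hy]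
      exact (hd y hy).2.1)
  have hzero : ∀ y : ℝ × ℝ, (if y ∈ Ioo 0 T ×ˢ Ioo 0 T then fderiv ℝ F y else 0) (1, 0) +
      (if y ∈ Ioo 0 T ×ˢ Ioo 0 T then fderiv ℝ G y else 0) (0, 1) = 0 := fun y => by
    split_ifs with hy
    · exact (hd y hy).2.2
    · simp
  simp only [hzero] at key
  have h1 : ∫ x in (0 : ℝ)..T, G (x, T) = 0 := by
    rw [intervalIntegral.integral_congr (g := fun _ => 0), intervalIntegral.integral_zero]
    intro x hx
    rw [uIcc_of_le hT] at hx
    simp [G, hU.initial x hx.1]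
  have h2 : ∫ x in (0 : ℝ)..T, G (x, 0) = 0 := by
    rw [intervalIntegral.integral_congr (g := fun _ => 0), intervalIntegral.integral_zero]
    intro x hx
    rw [uIcc_of_le hT] at hx
    simp [G, hu.initial x hx.1]
  have h3 : ∫ s in (0 : ℝ)..T, F (T, s) = 0 := by
    rw [intervalIntegral.integral_congr (g := fun _ => 0), intervalIntegral.integral_zero]
    intro s hs
    rw [uIcc_of_le hT] at hs
    simp [F, hfront T (T - s) (by linarith [hs.1])]
  have h4 : ∫ s in (0 : ℝ)..T, F (0, s) =
      ∫ s in (0 : ℝ)..T, (f s * U 0 (T - s) 1 - u 0 s 1 * g (T - s)) := by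
    refine intervalIntegral.integral_congr fun s hs => ?_
    rw [uIcc_of_le hT] at hs
    simp only [F]
    rw [hu.boundary s hs.1, hU.boundary (T - s) (by linarith [hs.2])]
  rw [h1, h2, h3, h4] at key
  simpa using key integrableOn_zero

theorem add_eq_zero_of_convolution_quad {φ H₀ H₁ H₂ H₃ : ℝ → ℂ} (hφ : Continuous φ)
    (h₃ : ∀ t, HasDerivAt H₃ (H₂ t) t) (h₂ : ∀ t, HasDerivAt H₂ (H₁ t) t)
    (h₁ : ∀ t, HasDerivAt H₁ (H₀ t) t)
    (h : ∀ T, 0 ≤ T → (∫ s in (0 : ℝ)..T, φ s * (((T - s : ℝ) : ℂ) ^ 2 / 2)) + H₃ T = 0)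
    (T : ℝ) (hT : 0 ≤ T) : φ T + H₀ T = 0 := by
  have k2 : ∀ t : ℝ, HasDerivAt (fun t : ℝ => (t : ℂ) ^ 2 / 2) (t : ℂ) t := fun t => by
    refine ((ofRealCLM.hasDerivAt (x := t)).pow 2).div_const 2 |>.congr_deriv ?_
    simp
  have k1 : ∀ t : ℝ, HasDerivAt (fun t : ℝ => (t : ℂ)) 1 t := fun t =>
    (ofRealCLM.hasDerivAt (x := t)).congr_deriv (by simp)
  have d3 : ∀ t, HasDerivAt (fun t : ℝ => (∫ s in (0 : ℝ)..t, φ s * (((t - s : ℝ) : ℂ) ^ 2 / 2)) +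
      H₃ t) ((∫ s in (0 : ℝ)..t, φ s * ((t - s : ℝ) : ℂ)) + H₂ t) t := fun t => by
    refine ((hasDerivAt_intervalIntegral_convolution (k := fun t : ℝ => (t : ℂ) ^ 2 / 2) hφ
      continuous_ofReal k2 t).add (h₃ t)).congr_deriv ?_
    simp
  have d2 : ∀ t, HasDerivAt (fun t : ℝ => (∫ s in (0 : ℝ)..t, φ s * ((t - s : ℝ) : ℂ)) +
      H₂ t) ((∫ s in (0 : ℝ)..t, φ s) + H₁ t) t := fun t => by
    refine ((hasDerivAt_intervalIntegral_convolution (k := fun t : ℝ => (t : ℂ)) hφ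
      continuous_const k1 t).add (h₂ t)).congr_deriv ?_
    simp
  have d1 : ∀ t, HasDerivAt (fun t : ℝ => (∫ s in (0 : ℝ)..t, φ s) + H₁ t) (φ t + H₀ t) t :=
    fun t => (hφ.integral_hasStrictDerivAt 0 t).hasDerivAt.add (h₁ t)
  exact eq_zero_of_hasDerivAt_of_eqOn_zero d1 (eq_zero_of_hasDerivAt_of_eqOn_zero d2
    (eq_zero_of_hasDerivAt_of_eqOn_zero d3 h)) T hT

variable {p q : ℝ → ℝ} {a b : ℝ → ℝ → ℂ}

theorem isResponseFunction_of_impulseResponse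
    (hw : Continuous (complexPotential p q)) (ha : Continuous (uncurry a))
    (hb : Continuous (uncurry b))
    (hab : ∀ x τ, a x τ = I * complexPotential p q (x + τ / 2) +
      reflectedWave (complexPotential p q) b x τ)
    (hba : ∀ x τ, b x τ = transmittedWave (complexPotential p q) a x τ) :
    IsResponseFunction p q (fun t => -I * a 0 t) := by
  obtain ⟨U, hU, hfront, htrace⟩ := exists_isClassicalSolution_quadControl hw ha hb hab hba
  refine ⟨(continuous_const.mul (ha.uncurry_left 0)).continuousOn, fun f u hf hu t ht => ?_⟩
  have hfc : Continuous f := hf.1.continuous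
  have hh : Continuous fun t => u 0 |t| 1 := by
    have h1 : ContinuousOn (fun y : ℝ × ℝ => u y.1 y.2 1) (Ici 0 ×ˢ Ici 0) :=
      (continuous_apply 1).comp_continuousOn hu.contDiffOn.continuousOn
    exact h1.comp_continuous (f := fun t : ℝ => ((0 : ℝ), |t|)) (by fun_prop)
      fun t => ⟨mem_Ici.2 le_rfl, abs_nonneg t⟩
  set r₀ : ℝ → ℂ := fun t => -I * a 0 t
  set r₁ : ℝ → ℂ := fun t => -I * primitiveSnd a 0 t with hr₁
  set r₂ : ℝ → ℂ := fun t => -I * primitiveSnd (primitiveSnd a) 0 t with hr₂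
  set r₃ : ℝ → ℂ := fun t => -I * primitiveSnd (primitiveSnd (primitiveSnd a)) 0 t with hr₃
  have ha1 := continuous_primitiveSnd ha
  have ha2 := continuous_primitiveSnd ha1
  have ha3 := continuous_primitiveSnd ha2
  have c0 : Continuous r₀ := continuous_const.mul (ha.uncurry_left 0)
  have c1 : Continuous r₁ := continuous_const.mul (ha1.uncurry_left 0)
  have c2 : Continuous r₂ := continuous_const.mul (ha2.uncurry_left 0)
  have c3 : Continuous r₃ := continuous_const.mul (ha3.uncurry_left 0)
  have d1 : ∀ t, HasDerivAt r₁ (r₀ t) t := fun t => (hasDerivAt_primitiveSnd ha 0 t).const_mul _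
  have d2 : ∀ t, HasDerivAt r₂ (r₁ t) t := fun t => (hasDerivAt_primitiveSnd ha1 0 t).const_mul _
  have d3 : ∀ t, HasDerivAt r₃ (r₂ t) t := fun t => (hasDerivAt_primitiveSnd ha2 0 t).const_mul _
  have hφ : Continuous fun s => I * f s - u 0 |s| 1 := (continuous_const.mul hfc).sub hh
  have key := add_eq_zero_of_convolution_quad (φ := fun s => I * f s - u 0 |s| 1)
    (H₀ := fun t => ∫ s in (0 : ℝ)..t, f s * r₀ (t - s))
    (H₁ := fun t => ∫ s in (0 : ℝ)..t, f s * r₁ (t - s))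
    (H₂ := fun t => ∫ s in (0 : ℝ)..t, f s * r₂ (t - s))
    (H₃ := fun t => ∫ s in (0 : ℝ)..t, f s * r₃ (t - s)) hφ
    (fun t => (hasDerivAt_intervalIntegral_convolution hfc c2 d3 t).congr_deriv (by simp [hr₃]))
    (fun t => (hasDerivAt_intervalIntegral_convolution hfc c1 d2 t).congr_deriv (by simp [hr₂]))
    (fun t => (hasDerivAt_intervalIntegral_convolution hfc c0 d1 t).congr_deriv (by simp [hr₁]))
    (fun T hT => by
      rw [← intervalIntegral.integral_add, ← hu.reciprocity hU hfront hT]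
      · refine intervalIntegral.integral_congr fun s hs => ?_
        rw [uIcc_of_le hT] at hs
        have hs' : 0 ≤ T - s := by linarith [hs.2]
        simp only [htrace _ hs', quadControl_of_nonneg hs', abs_of_nonneg hs.1, hr₃]
        ring
      · refine Continuous.intervalIntegrable (hφ.mul ?_) _ _
        fun_prop
      · exact Continuous.intervalIntegrable (by fun_prop) _ _) t ht
  simp only [abs_of_nonneg ht] at key
  have hcomm : ∫ s in (0 : ℝ)..t, r₀ (t - s) * f s = ∫ s in (0 : ℝ)..t, f s * r₀ (t - s) := by
    simp only [mul_comm]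
  rw [hcomm]
  linear_combination -key

theorem IsResponseFunction.eq_of_impulseResponse {r : ℝ → ℂ} (hr : IsResponseFunction p q r)
    (hw : Continuous (complexPotential p q)) (ha : Continuous (uncurry a))
    (hb : Continuous (uncurry b))
    (hab : ∀ x τ, a x τ = I * complexPotential p q (x + τ / 2) +
      reflectedWave (complexPotential p q) b x τ)
    (hba : ∀ x τ, b x τ = transmittedWave (complexPotential p q) a x τ) (t : ℝ) (ht : 0 ≤ t) :
    r t = -I * a 0 t := by
  obtain ⟨U, hU, -, htrace⟩ := exists_isClassicalSolution_quadControl hw ha hb hab hba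
  have hrc : Continuous fun t => r |t| :=
    hr.1.comp_continuous continuous_abs fun t => abs_nonneg t
  have ha1 := continuous_primitiveSnd ha
  have ha2 := continuous_primitiveSnd ha1
  have key := add_eq_zero_of_convolution_quad hrc
    (fun t => (hasDerivAt_primitiveSnd ha2 0 t).const_mul I)
    (fun t => (hasDerivAt_primitiveSnd ha1 0 t).const_mul I)
    (fun t => (hasDerivAt_primitiveSnd ha 0 t).const_mul I) (fun T hT => by
      have h1 := hr.2 quadControl U isControl_quadControl hU T hT
      rw [htrace T hT, quadControl_of_nonneg hT] at h1
      have h2 : ∫ s in (0 : ℝ)..T, r (T - s) * quadControl s =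
          ∫ s in (0 : ℝ)..T, r |s| * (((T - s : ℝ) : ℂ) ^ 2 / 2) := by
        have h3 := intervalIntegral.integral_comp_sub_left (a := 0) (b := T)
          (fun s => r |s| * (((T - s : ℝ) : ℂ) ^ 2 / 2)) T
        rw [sub_self, sub_zero] at h3
        rw [← h3]
        refine intervalIntegral.integral_congr fun s hs => ?_
        rw [uIcc_of_le hT] at hs
        have hs' : 0 ≤ T - s := by linarith [hs.2]
        simp [abs_of_nonneg hs', quadControl_of_nonneg hs.1]
      rw [← h2]
      linear_combination -h1) t ht
  simp only [abs_of_nonneg ht] at key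
  linear_combination key

end Response

/-! ### The Laplace transform of the impulse response -/

section Laplace

open Function ComplexConjugate Filter Topology

theorem norm_cexp_I_mul (z : ℂ) (t : ℝ) : ‖cexp (I * z * t)‖ = Real.exp (-(z.im * t)) := by
  rw [Complex.norm_exp]
  simp

theorem integral_Ioi_comp_add_right {E : Type*} [NormedAddCommGroup E] [NormedSpace ℝ E]
    (g : ℝ → E) (c x : ℝ) : ∫ y in Ioi c, g (y + x) = ∫ y in Ioi (c + x), g y := by
  rw [← integral_indicator measurableSet_Ioi, ← integral_indicator measurableSet_Ioi,
    ← integral_add_right_eq_self ((Ioi (c + x)).indicator g) x]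
  congr 1
  ext y
  simp [indicator]

/-- The Fourier-Laplace transform in the second variable. -/
def laplaceSnd (z : ℂ) (F : ℝ → ℝ → ℂ) (x : ℝ) : ℂ := ∫ τ in Ioi (0 : ℝ), cexp (I * z * τ) * F x τ

variable {F : ℝ → ℝ → ℂ} {C κ : ℝ} {z : ℂ}

theorem norm_laplace_integrand_le (hF : ∀ x τ, ‖F x τ‖ ≤ C * Real.exp (κ * (|x| + |τ|)))
    (x : ℝ) {τ : ℝ} (hτ : 0 < τ) :
    ‖cexp (I * z * τ) * F x τ‖ ≤ C * Real.exp (κ * |x|) * Real.exp ((κ - z.im) * τ) := by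
  rw [norm_mul, norm_cexp_I_mul]
  calc _ ≤ Real.exp (-(z.im * τ)) * (C * Real.exp (κ * (|x| + |τ|))) := by gcongr; exact hF x τ
    _ = C * (Real.exp (-(z.im * τ)) * Real.exp (κ * (|x| + |τ|))) := by ring
    _ = C * (Real.exp (κ * |x|) * Real.exp ((κ - z.im) * τ)) := by
        rw [← Real.exp_add, ← Real.exp_add, abs_of_pos hτ]; ring_nf
    _ = _ := by ring

theorem continuous_laplace_integrand (hFc : Continuous (uncurry F)) (x : ℝ) :
    Continuous fun τ : ℝ => cexp (I * z * τ) * F x τ := by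
  have := hFc.uncurry_left x
  fun_prop

theorem integrableOn_laplace (hFc : Continuous (uncurry F))
    (hF : ∀ x τ, ‖F x τ‖ ≤ C * Real.exp (κ * (|x| + |τ|))) (hz : κ < z.im) (x : ℝ) :
    IntegrableOn (fun τ : ℝ => cexp (I * z * τ) * F x τ) (Ioi 0) := by
  refine Integrable.mono' ((integrableOn_exp_mul_Ioi (sub_neg.2 hz) 0).const_mul
    (C * Real.exp (κ * |x|))) (continuous_laplace_integrand hFc x).aestronglyMeasurable ?_
  filter_upwards [ae_restrict_mem measurableSet_Ioi] with τ hτ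
  exact norm_laplace_integrand_le hF x hτ

theorem norm_laplaceSnd_le (hF : ∀ x τ, ‖F x τ‖ ≤ C * Real.exp (κ * (|x| + |τ|)))
    (hz : κ < z.im) (x : ℝ) :
    ‖laplaceSnd z F x‖ ≤ C / (z.im - κ) * Real.exp (κ * |x|) := by
  have h1 : ‖laplaceSnd z F x‖ ≤
      ∫ τ in Ioi (0 : ℝ), C * Real.exp (κ * |x|) * Real.exp ((κ - z.im) * τ) := by
    refine norm_integral_le_of_norm_le ((integrableOn_exp_mul_Ioi (sub_neg.2 hz) 0).const_mul
      (C * Real.exp (κ * |x|))) ?_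
    filter_upwards [ae_restrict_mem measurableSet_Ioi] with τ hτ
    exact norm_laplace_integrand_le hF x hτ
  rw [integral_const_mul, integral_exp_mul_Ioi (sub_neg.2 hz)] at h1
  refine h1.trans_eq ?_
  have : κ - z.im ≠ 0 := (sub_neg.2 hz).ne
  have : z.im - κ ≠ 0 := (sub_pos.2 hz).ne'
  simp
  grind

theorem continuous_laplaceSnd (hFc : Continuous (uncurry F)) (hκ : 0 < κ)
    (hF : ∀ x τ, ‖F x τ‖ ≤ C * Real.exp (κ * (|x| + |τ|))) (hz : κ < z.im) :
    Continuous (laplaceSnd z F) := by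
  have hC0 : 0 ≤ C := by
    have := (norm_nonneg _).trans (hF 0 0)
    simpa using this
  refine continuous_iff_continuousAt.2 fun x₀ => ?_
  refine continuousAt_of_dominated
    (bound := fun τ => C * Real.exp (κ * (|x₀| + 1)) * Real.exp ((κ - z.im) * τ))
    (.of_forall fun x => (continuous_laplace_integrand hFc x).aestronglyMeasurable) ?_
    ((integrableOn_exp_mul_Ioi (sub_neg.2 hz) 0).const_mul _) (.of_forall fun τ => ?_)
  · filter_upwards [Metric.ball_mem_nhds x₀ one_pos] with x hx
    filter_upwards [ae_restrict_mem measurableSet_Ioi] with τ hτ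
    refine (norm_laplace_integrand_le hF x hτ).trans ?_
    have : |x| ≤ |x₀| + 1 := by
      have h1 : |x - x₀| < 1 := by simpa [Real.dist_eq] using hx
      have h2 := abs_add_le x₀ (x - x₀)
      rw [add_sub_cancel] at h2
      linarith
    gcongr
  · have : Continuous fun x => uncurry F (x, τ) := by fun_prop
    exact (continuous_const.mul this).continuousAt

variable {w : ℝ → ℂ} {a b : ℝ → ℝ → ℂ} {M : ℝ}

theorem laplaceSnd_transmittedWave (hw : Continuous w) (ha : Continuous (uncurry a))
    (hκ : 0 < κ) (hM : ∀ x, ‖w x‖ ≤ M) (hMκ : M ≤ κ)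
    (hab : ∀ x τ, ‖a x τ‖ ≤ C * Real.exp (κ * (|x| + |τ|))) (hz : κ < z.im) (x : ℝ) :
    laplaceSnd z (transmittedWave w a) x =
      -laplaceSnd z a 0 + ∫ y in (0 : ℝ)..x, I * conj (w y) * laplaceSnd z a y := by
  have hM0 : 0 ≤ M := (norm_nonneg _).trans (hM 0)
  have hC0 : 0 ≤ C := by
    have := (norm_nonneg _).trans (hab 0 0)
    simpa using this
  have hcont : Continuous fun u : ℝ × ℝ =>
      cexp (I * z * u.2) * (I * conj (w u.1) * uncurry a u) := by
    have := (continuous_conj_comp hw).comp (continuous_fst (X := ℝ) (Y := ℝ))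
    have h2 : Continuous fun u : ℝ × ℝ => conj (w u.1) := this
    fun_prop
  have hint : Integrable (uncurry fun y (τ : ℝ) => cexp (I * z * τ) * (I * conj (w y) * a y τ))
      ((volume.restrict (uIoc 0 x)).prod (volume.restrict (Ioi 0))) := by
    have hb1 : Integrable (fun y : ℝ => M * C * Real.exp (κ * |y|)) (volume.restrict (uIoc 0 x)) :=
      (intervalIntegrable_iff.1 (Continuous.intervalIntegrable (by fun_prop) 0 x))
    refine Integrable.mono' (hb1.mul_prod (integrableOn_exp_mul_Ioi (sub_neg.2 hz) 0))
      hcont.aestronglyMeasurable ?_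
    rw [Measure.prod_restrict]
    filter_upwards [ae_restrict_mem (measurableSet_uIoc.prod measurableSet_Ioi)] with u hu
    have h1 := norm_laplace_integrand_le (z := z) hab u.1 hu.2
    calc ‖cexp (I * z * u.2) * (I * conj (w u.1) * a u.1 u.2)‖
        = ‖w u.1‖ * ‖cexp (I * z * u.2) * a u.1 u.2‖ := by
          simp only [norm_mul, norm_I, RCLike.norm_conj]; ring
      _ ≤ M * (C * Real.exp (κ * |u.1|) * Real.exp ((κ - z.im) * u.2)) := by
          gcongr
          exact hM _
      _ = _ := by ring
  have h1 : (∫ y in (0 : ℝ)..x, I * conj (w y) * laplaceSnd z a y) =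
      ∫ τ in Ioi (0 : ℝ), cexp (I * z * τ) * ∫ y in (0 : ℝ)..x, I * conj (w y) * a y τ := by
    rw [← intervalIntegral.integral_congr fun y _ => ?_,
      intervalIntegral_integral_swap hint]
    · refine integral_congr_ae (.of_forall fun τ => ?_)
      exact intervalIntegral.integral_const_mul _ _
    · simp only [laplaceSnd]
      rw [← integral_const_mul]
      refine integral_congr_ae (.of_forall fun τ => ?_)
      simp only
      ring
  have h2 : IntegrableOn (fun τ : ℝ => cexp (I * z * τ) *
      ∫ y in (0 : ℝ)..x, I * conj (w y) * a y τ) (Ioi 0) := by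
    refine ((integrableOn_laplace (continuous_transmittedWave hw ha)
      (norm_transmittedWave_le hM hκ hMκ hab) hz x).add (integrableOn_laplace ha hab hz 0)).congr
      (.of_forall fun τ => ?_)
    simp only [transmittedWave, Pi.add_apply]
    ring
  have h3 := integral_add (integrableOn_laplace ha hab hz 0).neg h2
  rw [h1, laplaceSnd, laplaceSnd, ← integral_neg]
  refine Eq.trans ?_ h3
  refine integral_congr_ae (.of_forall fun τ => ?_)
  simp only [transmittedWave, Pi.neg_apply]
  ring

theorem integral_reflectedWave_eq (x τ : ℝ) (hτ : 0 < τ) :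
    reflectedWave w b x τ = ∫ y in Ioi (0 : ℝ),
      (Ioi (2 * y)).indicator (fun τ => I * w (x + y) * b (x + y) (τ - 2 * y)) τ := by
  have h1 : ∀ y, (Ioi (2 * y)).indicator (fun τ => I * w (x + y) * b (x + y) (τ - 2 * y)) τ =
      (Iio (τ / 2)).indicator (fun y => I * w (x + y) * b (x + y) (τ - 2 * y)) y := fun y => by
    have : 2 * y < τ ↔ y < τ / 2 := by constructor <;> intro h <;> linarith
    simp [indicator, this]
  simp only [h1]
  rw [setIntegral_indicator measurableSet_Iio, Ioi_inter_Iio, ← integral_Ioc_eq_integral_Ioo,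
    ← intervalIntegral.integral_of_le (by linarith), reflectedWave]
  have h2 := intervalIntegral.integral_comp_add_left (a := 0) (b := τ / 2)
    (fun y => I * w y * b y (2 * (x - y) + τ)) x
  rw [add_zero] at h2
  rw [← h2]
  refine intervalIntegral.integral_congr fun y _ => ?_
  ring_nf

theorem laplaceSnd_reflectedWave (hw : Continuous w) (hbc : Continuous (uncurry b))
    (hκ : 0 < κ) (hM : ∀ x, ‖w x‖ ≤ M)
    (hb : ∀ x τ, ‖b x τ‖ ≤ C * Real.exp (κ * (|x| + |τ|))) (hz : κ < z.im) (x : ℝ) :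
    laplaceSnd z (reflectedWave w b) x =
      ∫ y in Ioi (0 : ℝ), cexp (2 * I * z * y) * (I * w (x + y) * laplaceSnd z b (x + y)) := by
  have hM0 : 0 ≤ M := (norm_nonneg _).trans (hM 0)
  have hC0 : 0 ≤ C := by
    have := (norm_nonneg _).trans (hb 0 0)
    simpa using this
  let Φ : ℝ → ℝ → ℂ := fun τ y => (Ioi (2 * y)).indicator
    (fun τ => cexp (I * z * τ) * (I * w (x + y) * b (x + y) (τ - 2 * y))) τ
  have hmeas : Measurable (uncurry Φ) := by
    have h1 : Continuous fun u : ℝ × ℝ =>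
        cexp (I * z * u.1) * (I * w (x + u.2) * uncurry b (x + u.2, u.1 - 2 * u.2)) := by fun_prop
    have h2 : MeasurableSet {u : ℝ × ℝ | 2 * u.2 < u.1} :=
      measurableSet_lt (by fun_prop) (by fun_prop)
    exact h1.measurable.indicator h2
  have hint : Integrable (uncurry Φ) ((volume.restrict (Ioi 0)).prod (volume.restrict (Ioi 0))) := by
    refine Integrable.mono' ((integrableOn_exp_mul_Ioi (sub_neg.2 hz) 0).mul_prod
      ((integrableOn_exp_mul_Ioi (neg_lt_zero.2 hκ) 0).const_mul (M * C * Real.exp (κ * |x|))))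
      hmeas.aestronglyMeasurable ?_
    rw [Measure.prod_restrict]
    filter_upwards [ae_restrict_mem (measurableSet_Ioi.prod measurableSet_Ioi)] with u hu
    have hy : 0 < u.2 := hu.2
    by_cases hlt : 2 * u.2 < u.1
    · have h1 : ‖uncurry Φ u‖ = Real.exp (-(z.im * u.1)) *
          (‖w (x + u.2)‖ * ‖b (x + u.2) (u.1 - 2 * u.2)‖) := by
        simp only [uncurry, Φ, indicator, mem_Ioi, if_pos hlt, norm_mul, norm_cexp_I_mul, norm_I,
          one_mul]
      rw [h1]
      have h2 : |x + u.2| + |u.1 - 2 * u.2| ≤ |x| + u.1 - u.2 := by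
        have := abs_add_le x u.2
        rw [abs_of_pos hy] at this
        rw [abs_of_pos (by linarith : 0 < u.1 - 2 * u.2)]
        linarith
      calc _ ≤ Real.exp (-(z.im * u.1)) * (M * (C * Real.exp (κ * (|x| + u.1 - u.2)))) := by
            gcongr
            · exact hM _
            · exact (hb _ _).trans (by gcongr)
        _ = M * C * (Real.exp (-(z.im * u.1)) * Real.exp (κ * (|x| + u.1 - u.2))) := by ring
        _ = M * C * (Real.exp (κ * |x|) * (Real.exp ((κ - z.im) * u.1) * Real.exp (-κ * u.2))) := by
            rw [← Real.exp_add, ← Real.exp_add, ← Real.exp_add]; ring_nf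
        _ = _ := by ring
    · have h1 : uncurry Φ u = 0 := by simp only [uncurry, Φ, indicator, mem_Ioi, if_neg hlt]
      rw [h1, norm_zero]
      positivity
  calc laplaceSnd z (reflectedWave w b) x = ∫ τ in Ioi (0 : ℝ), ∫ y in Ioi (0 : ℝ), Φ τ y := by
        refine setIntegral_congr_fun measurableSet_Ioi fun τ hτ => ?_
        rw [integral_reflectedWave_eq x τ hτ, ← integral_const_mul]
        refine integral_congr_ae (.of_forall fun y => ?_)
        simp only [Φ, indicator]
        split_ifs <;> simp
    _ = ∫ y in Ioi (0 : ℝ), ∫ τ in Ioi (0 : ℝ), Φ τ y := integral_integral_swap hint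
    _ = _ := by
        refine setIntegral_congr_fun measurableSet_Ioi fun y hy => ?_
        have hy : 0 < y := hy
        simp only [Φ]
        rw [setIntegral_indicator measurableSet_Ioi, Ioi_inter_Ioi, max_eq_right (by linarith)]
        have h1 := integral_Ioi_comp_add_right
          (fun τ : ℝ => cexp (I * z * τ) * (I * w (x + y) * b (x + y) (τ - 2 * y))) 0 (2 * y)
        rw [zero_add] at h1
        rw [← h1, laplaceSnd, ← integral_const_mul, ← integral_const_mul]
        refine integral_congr_ae (.of_forall fun τ => ?_)
        simp only
        rw [add_sub_cancel_right, show I * z * ((τ + 2 * y : ℝ) : ℂ) =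
          2 * I * z * y + I * z * τ by push_cast; ring, Complex.exp_add]
        ring

/-- The Laplace transform of the impulse response is a decaying solution of the spectral system. -/
theorem exists_decaying_solution (hw : Continuous w) (hM : ∀ x, ‖w x‖ ≤ M) (hMκ : M < κ)
    (hz : κ < z.im) (hac : Continuous (uncurry a)) (hbc : Continuous (uncurry b))
    (ha : ∀ x τ, ‖a x τ‖ ≤ C * Real.exp (κ * (|x| + |τ|)))
    (hb : ∀ x τ, ‖b x τ‖ ≤ C * Real.exp (κ * (|x| + |τ|)))
    (hab : ∀ x τ, a x τ = I * w (x + τ / 2) + reflectedWave w b x τ)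
    (hba : ∀ x τ, b x τ = transmittedWave w a x τ) :
    ∃ y₁ y₂ : ℝ → ℂ, ∃ D : ℝ, y₁ 0 = 2 - laplaceSnd z a 0 ∧ y₂ 0 = -laplaceSnd z a 0 ∧
      (∀ x, HasDerivAt y₁ (I * z * y₁ x - I * conj (w x) * y₂ x) x) ∧
      (∀ x, HasDerivAt y₂ (-I * z * y₂ x + I * w x * y₁ x) x) ∧
      (∀ x, 0 ≤ x → ‖y₁ x‖ ≤ D * Real.exp (-(z.im - κ) * x)) ∧
      ∀ x, 0 ≤ x → ‖y₂ x‖ ≤ D * Real.exp (-(z.im - κ) * x) := by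
  have hM0 : 0 ≤ M := (norm_nonneg _).trans (hM 0)
  have hκ : 0 < κ := hM0.trans_lt hMκ
  have hC0 : 0 ≤ C := by
    have := (norm_nonneg _).trans (ha 0 0)
    simpa using this
  have hz0 : 0 < z.im - κ := sub_pos.2 hz
  have hLa := continuous_laplaceSnd hac hκ ha hz
  have hLb := continuous_laplaceSnd hbc hκ hb hz
  have hb' : ∀ x, laplaceSnd z b x =
      -laplaceSnd z a 0 + ∫ y in (0 : ℝ)..x, I * conj (w y) * laplaceSnd z a y := fun x => by
    rw [← laplaceSnd_transmittedWave hw hac hκ hM hMκ.le ha hz x, ← funext₂ hba]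
  set k : ℝ → ℂ := fun y => cexp (2 * I * z * y) * (I * w y * (2 + laplaceSnd z b y)) with hk
  have hkc : Continuous k := by fun_prop
  have ha' : ∀ x, laplaceSnd z a x = cexp (-(2 * I * z * x)) *
      (laplaceSnd z a 0 - ∫ y in (0 : ℝ)..x, k y) := by
    have hgen : ∀ (c : ℝ → ℂ) (R : ℝ), Continuous c → (∀ y, 0 < y → ‖c y‖ ≤ R * Real.exp (κ * y)) →
        IntegrableOn (fun y : ℝ => cexp (2 * I * z * y) * c y) (Ioi 0) := by
      intro c R hc hR
      refine Integrable.mono' ((integrableOn_exp_mul_Ioi (a := κ - 2 * z.im) (by linarith)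
        0).const_mul R) (Continuous.aestronglyMeasurable (by fun_prop)) ?_
      filter_upwards [ae_restrict_mem measurableSet_Ioi] with y hy
      have h2 : ‖cexp (2 * I * z * y)‖ = Real.exp (-(2 * z.im * y)) := by
        rw [Complex.norm_exp]; simp
      rw [norm_mul, h2]
      calc _ ≤ Real.exp (-(2 * z.im * y)) * (R * Real.exp (κ * y)) := by gcongr; exact hR y hy
        _ = R * (Real.exp (-(2 * z.im * y)) * Real.exp (κ * y)) := by ring
        _ = _ := by rw [← Real.exp_add]; ring_nf
    have hwR : ∀ x y, 0 < y → ‖I * w (x + y) * 2‖ ≤ M * 2 * Real.exp (κ * y) := fun x y hy => by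
      rw [norm_mul, norm_mul, norm_I, one_mul, RCLike.norm_ofNat]
      have : 1 ≤ Real.exp (κ * y) := Real.one_le_exp (by positivity)
      calc _ ≤ M * 2 * 1 := by rw [mul_one]; gcongr; exact hM _
        _ ≤ _ := by gcongr
    have hbR : ∀ x y, 0 < y → ‖I * w (x + y) * laplaceSnd z b (x + y)‖ ≤
        M * (C / (z.im - κ) * Real.exp (κ * |x|)) * Real.exp (κ * y) := fun x y hy => by
      rw [norm_mul, norm_mul, norm_I, one_mul]
      calc _ ≤ M * (C / (z.im - κ) * Real.exp (κ * |x + y|)) := by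
            gcongr
            · exact hM _
            · exact norm_laplaceSnd_le hb hz _
        _ ≤ M * (C / (z.im - κ) * Real.exp (κ * (|x| + y))) := by
            gcongr
            have := abs_add_le x y
            rwa [abs_of_pos hy] at this
        _ = M * (C / (z.im - κ) * (Real.exp (κ * |x|) * Real.exp (κ * y))) := by
            rw [← Real.exp_add]; ring_nf
        _ = _ := by ring
    have hi1 : ∀ x, IntegrableOn (fun y : ℝ => cexp (2 * I * z * y) * (I * w (x + y) * 2)) (Ioi 0) :=
      fun x => hgen _ _ (by fun_prop) (hwR x)
    have hi2 : ∀ x, IntegrableOn (fun y : ℝ => cexp (2 * I * z * y) *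
        (I * w (x + y) * laplaceSnd z b (x + y))) (Ioi 0) :=
      fun x => hgen _ _ (by fun_prop) (hbR x)
    have hki : ∀ c, IntegrableOn k (Ioi c) := fun c => by
      have h0 : IntegrableOn k (Ioi 0) := by
        refine ((hi1 0).add (hi2 0)).congr (.of_forall fun y => ?_)
        simp only [hk, Pi.add_apply, zero_add]
        ring
      refine (h0.union (hkc.integrableOn_Icc (a := c) (b := 0))).mono_set fun y hy => ?_
      rcases lt_or_ge 0 y with h | h
      · exact Or.inl h
      · exact Or.inr ⟨le_of_lt hy, h⟩
    have h1 : ∀ x, laplaceSnd z a x = cexp (-(2 * I * z * x)) * ∫ y in Ioi x, k y := fun x => by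
      have e1 := integral_comp_mul_left_Ioi'
        (fun τ : ℝ => cexp (I * z * τ) * (I * w (x + τ / 2))) 0 (two_pos : (0 : ℝ) < 2)
      have e2 := integral_Ioi_comp_add_right k 0 x
      rw [mul_zero] at e1
      rw [zero_add] at e2
      have i1 : IntegrableOn (fun τ : ℝ => cexp (I * z * τ) * (I * w (x + τ / 2))) (Ioi 0) := by
        refine Integrable.mono' ((integrableOn_exp_mul_Ioi (a := -z.im) (by linarith)
          0).const_mul M) (Continuous.aestronglyMeasurable (by fun_prop)) (.of_forall fun τ => ?_)
        rw [norm_mul, norm_mul, norm_I, one_mul, norm_cexp_I_mul, mul_comm, neg_mul]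
        gcongr
        exact hM _
      have i2 := integrableOn_laplace (continuous_reflectedWave hw hbc) (norm_reflectedWave_le hM hκ hb)
        hz x
      calc laplaceSnd z a x = (∫ τ in Ioi (0 : ℝ), cexp (I * z * τ) * (I * w (x + τ / 2))) +
            laplaceSnd z (reflectedWave w b) x := by
            rw [laplaceSnd, laplaceSnd, ← integral_add i1 i2]
            refine integral_congr_ae (.of_forall fun τ => ?_)
            simp only [hab]
            ring
        _ = (∫ y in Ioi (0 : ℝ), cexp (2 * I * z * y) * (I * w (x + y) * 2)) +
            ∫ y in Ioi (0 : ℝ), cexp (2 * I * z * y) * (I * w (x + y) * laplaceSnd z b (x + y)) := by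
            rw [laplaceSnd_reflectedWave hw hbc hκ hM hb hz, ← e1, ← integral_smul]
            congr 1
            refine integral_congr_ae (.of_forall fun y => ?_)
            simp only [real_smul]
            rw [mul_div_cancel_left₀ y two_ne_zero]
            push_cast
            ring_nf
        _ = _ := by
            rw [← integral_add (hi1 x) (hi2 x), ← e2, ← integral_const_mul]
            refine integral_congr_ae (.of_forall fun y => ?_)
            simp only [hk]
            rw [show 2 * I * z * ((y + x : ℝ) : ℂ) = 2 * I * z * x + 2 * I * z * y by
              push_cast; ring, Complex.exp_add, Complex.exp_neg, add_comm y x]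
            field_simp
    intro x
    have h2 := h1 0
    simp only [ofReal_zero, mul_zero, neg_zero, Complex.exp_zero, one_mul] at h2
    rw [h1, h2, ← intervalIntegral.integral_interval_add_Ioi (hki 0) (hki x)]
    ring
  have hda : ∀ x, HasDerivAt (laplaceSnd z a)
      (-(2 * I * z) * laplaceSnd z a x - I * w x * (2 + laplaceSnd z b x)) x := fun x => by
    have h1 : HasDerivAt (fun x : ℝ => cexp (-(2 * I * z * x)))
        (cexp (-(2 * I * z * x)) * -(2 * I * z)) x := by
      have := ((ofRealCLM.hasDerivAt (x := x)).const_mul (2 * I * z)).neg.cexp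
      simpa using! this
    have h2 := (hkc.integral_hasStrictDerivAt 0 x).hasDerivAt.const_sub (laplaceSnd z a 0)
    refine ((h1.mul h2).congr_of_eventuallyEq (.of_forall ha')).congr_deriv ?_
    rw [ha' x]
    have h3 : cexp (-(2 * I * z * x)) * cexp (2 * I * z * x) = 1 := by
      rw [← Complex.exp_add]; simp
    simp only [hk]
    linear_combination (-(I * w x * (2 + laplaceSnd z b x))) * h3
  have hdb : ∀ x, HasDerivAt (laplaceSnd z b) (I * conj (w x) * laplaceSnd z a x) x := fun x => by
    have h1 : Continuous fun y => I * conj (w y) * laplaceSnd z a y := by fun_prop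
    exact ((h1.integral_hasStrictDerivAt 0 x).hasDerivAt.const_add
      (-laplaceSnd z a 0)).congr_of_eventuallyEq (.of_forall hb')
  have he : ∀ x : ℝ, HasDerivAt (fun x : ℝ => cexp (I * z * x)) (cexp (I * z * x) * (I * z)) x :=
    fun x => by
    have := ((ofRealCLM.hasDerivAt (x := x)).const_mul (I * z)).cexp
    simpa using! this
  have hnorm : ∀ x, 0 ≤ x → ∀ c : ℂ, ‖c‖ ≤ (2 + C / (z.im - κ)) * Real.exp (κ * |x|) →
      ‖cexp (I * z * x) * c‖ ≤ (2 + C / (z.im - κ)) * Real.exp (-(z.im - κ) * x) := by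
    intro x hx c hc
    rw [norm_mul, norm_cexp_I_mul]
    calc _ ≤ Real.exp (-(z.im * x)) * ((2 + C / (z.im - κ)) * Real.exp (κ * |x|)) := by gcongr
      _ = (2 + C / (z.im - κ)) * (Real.exp (-(z.im * x)) * Real.exp (κ * |x|)) := by ring
      _ = _ := by rw [← Real.exp_add, abs_of_nonneg hx]; ring_nf
  refine ⟨fun x => cexp (I * z * x) * (2 + laplaceSnd z b x),
    fun x => cexp (I * z * x) * -laplaceSnd z a x, 2 + C / (z.im - κ), ?_, ?_, fun x => ?_,
    fun x => ?_, fun x hx => hnorm x hx _ ?_, fun x hx => hnorm x hx _ ?_⟩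
  · simp [hb' 0, sub_eq_add_neg]
  · simp
  · refine ((he x).mul ((hdb x).const_add 2)).congr_deriv ?_
    ring
  · refine ((he x).mul (hda x).neg).congr_deriv ?_
    simp only [Pi.neg_apply]
    ring
  · refine (norm_add_le _ _).trans ?_
    rw [add_mul]
    refine add_le_add ?_ (norm_laplaceSnd_le hb hz x)
    have : 1 ≤ Real.exp (κ * |x|) := Real.one_le_exp (by positivity)
    simpa using this
  · rw [norm_neg, add_mul]
    exact (norm_laplaceSnd_le ha hz x).trans (le_add_of_nonneg_left (by positivity))

end Laplace

/-! ### Square summable solutions of the spectral system -/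

section Spectral

open Function ComplexConjugate Filter Topology

/-- The spectral system for a column `(y₁, y₂)` on the half-line. -/
def IsSpectralSolution (v : ℝ → ℂ) (z : ℂ) (y₁ y₂ : ℝ → ℂ) : Prop :=
  ∀ x, 0 ≤ x → HasDerivWithinAt y₁ (I * z * y₁ x + I * v x * y₂ x) (Ici 0) x ∧
    HasDerivWithinAt y₂ (-I * z * y₂ x - I * conj (v x) * y₁ x) (Ici 0) x

variable {v : ℝ → ℂ} {z : ℂ} {Y : ℝ → Matrix (Fin 2) (Fin 2) ℂ} {y₁ y₂ u₁ u₂ : ℝ → ℂ}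

theorem spectral_generator_mul (v : ℝ → ℂ) (z : ℂ) (x : ℝ) (A : Matrix (Fin 2) (Fin 2) ℂ)
    (k : Fin 2) :
    ((I • (z • specj + specj * specV v x)) * A) 0 k = I * z * A 0 k + I * v x * A 1 k ∧
    ((I • (z • specj + specj * specV v x)) * A) 1 k =
      -I * z * A 1 k - I * conj (v x) * A 0 k := by
  constructor
  · simp [specj, specV, Matrix.mul_apply, Fin.sum_univ_two]
  · simp [specj, specV, Matrix.mul_apply, Fin.sum_univ_two]
    ring

theorem isFundamentalSolution_iff : IsFundamentalSolution v z Y ↔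
    Y 0 = 1 ∧ ∀ k, IsSpectralSolution v z (fun x => Y x 0 k) (fun x => Y x 1 k) := by
  refine and_congr_right fun _ => ⟨fun h k x hx => ?_, fun h x hx i k => ?_⟩
  · have h0 := h x hx 0 k
    have h1 := h x hx 1 k
    rw [(spectral_generator_mul v z x (Y x) k).1] at h0
    rw [(spectral_generator_mul v z x (Y x) k).2] at h1
    exact ⟨h0, h1⟩
  · fin_cases i
    · have := (h k x hx).1
      rw [← (spectral_generator_mul v z x (Y x) k).1] at this
      exact this
    · have := (h k x hx).2
      rw [← (spectral_generator_mul v z x (Y x) k).2] at this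
      exact this

theorem IsSpectralSolution.add_mul (hy : IsSpectralSolution v z y₁ y₂)
    (hu : IsSpectralSolution v z u₁ u₂) (c d : ℂ) :
    IsSpectralSolution v z (fun x => c * y₁ x + d * u₁ x) (fun x => c * y₂ x + d * u₂ x) :=
  fun x hx => ⟨(((hy x hx).1.const_mul c).add ((hu x hx).1.const_mul d)).congr_deriv (by ring),
    (((hy x hx).2.const_mul c).add ((hu x hx).2.const_mul d)).congr_deriv (by ring)⟩

/-- The Wronskian of two solutions is constant. -/
theorem IsSpectralSolution.wronskian_eq (hy : IsSpectralSolution v z y₁ y₂)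
    (hu : IsSpectralSolution v z u₁ u₂) {x : ℝ} (hx : 0 ≤ x) :
    y₁ x * u₂ x - y₂ x * u₁ x = y₁ 0 * u₂ 0 - y₂ 0 * u₁ 0 := by
  have hd : ∀ x, 0 ≤ x → HasDerivWithinAt (fun x => y₁ x * u₂ x - y₂ x * u₁ x) 0 (Ici 0) x :=
    fun x hx => (((hy x hx).1.mul (hu x hx).2).sub ((hy x hx).2.mul (hu x hx).1)).congr_deriv
      (by ring)
  exact constant_of_has_deriv_right_zero
    (fun t ht => ((hd t ht.1).continuousWithinAt).mono Icc_subset_Ici_self)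
    (fun t ht => (hd t ht.1).mono (Ici_subset_Ici.2 ht.1)) x ⟨hx, le_rfl⟩

theorem exists_isFundamentalSolution {M : ℝ} (hv : ContinuousOn v (Ici 0))
    (hM : ∀ x, 0 ≤ x → ‖v x‖ ≤ M) (z : ℂ) : ∃ Y, IsFundamentalSolution v z Y := by
  have hM0 : 0 ≤ M := (norm_nonneg _).trans (hM 0 le_rfl)
  have hvc : Continuous fun t => v |t| := hv.comp_continuous continuous_abs fun t => abs_nonneg t
  let F : ℝ → (Fin 2 → ℂ) → (Fin 2 → ℂ) := fun t y =>
    ![I * z * y 0 + I * v |t| * y 1, -I * z * y 1 - I * conj (v |t|) * y 0]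
  have hF : Continuous (uncurry F) := by
    have h1 : Continuous fun u : ℝ × (Fin 2 → ℂ) => v |u.1| := hvc.comp continuous_fst
    have h2 : Continuous fun u : ℝ × (Fin 2 → ℂ) => conj (v |u.1|) := continuous_conj.comp h1
    have h3 : Continuous fun u : ℝ × (Fin 2 → ℂ) => u.2 0 :=
      (continuous_apply 0).comp continuous_snd
    have h4 : Continuous fun u : ℝ × (Fin 2 → ℂ) => u.2 1 :=
      (continuous_apply 1).comp continuous_snd
    refine continuous_pi fun i => ?_
    fin_cases i
    · change Continuous fun u : ℝ × (Fin 2 → ℂ) => I * z * u.2 0 + I * v |u.1| * u.2 1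
      exact (continuous_const.mul h3).add ((continuous_const.mul h1).mul h4)
    · change Continuous fun u : ℝ × (Fin 2 → ℂ) => -I * z * u.2 1 - I * conj (v |u.1|) * u.2 0
      exact (continuous_const.mul h4).sub ((continuous_const.mul h2).mul h3)
  have hL : ∀ t x y, ‖F t x - F t y‖ ≤ (‖z‖ + M + 1) * ‖x - y‖ := by
    intro t x y
    have hvt := hM |t| (abs_nonneg t)
    have h0 : ‖x 0 - y 0‖ ≤ ‖x - y‖ := norm_le_pi_norm (x - y) 0
    have h1 : ‖x 1 - y 1‖ ≤ ‖x - y‖ := norm_le_pi_norm (x - y) 1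
    have hb : ∀ c d : ℂ, ‖c‖ ≤ ‖x - y‖ → ‖d‖ ≤ ‖x - y‖ → ‖z‖ * ‖c‖ + ‖v |t|‖ * ‖d‖ ≤
        (‖z‖ + M + 1) * ‖x - y‖ := fun c d hc hd => by
      calc _ ≤ ‖z‖ * ‖x - y‖ + M * ‖x - y‖ := by gcongr
        _ ≤ _ := by nlinarith [norm_nonneg (x - y)]
    refine (pi_norm_le_iff_of_nonneg (by positivity)).2 fun i => ?_
    fin_cases i
    · have e : (F t x - F t y) 0 = I * z * (x 0 - y 0) + I * v |t| * (x 1 - y 1) := by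
        simp [F]; ring
      change ‖(F t x - F t y) 0‖ ≤ _
      rw [e]
      refine (norm_add_le _ _).trans ?_
      simp only [norm_mul, norm_I, one_mul]
      exact hb _ _ h0 h1
    · have e : (F t x - F t y) 1 = -I * z * (x 1 - y 1) + -I * conj (v |t|) * (x 0 - y 0) := by
        simp [F]; ring
      change ‖(F t x - F t y) 1‖ ≤ _
      rw [e]
      refine (norm_add_le _ _).trans ?_
      simp only [norm_mul, norm_neg, norm_I, one_mul, RCLike.norm_conj]
      exact hb _ _ h1 h0
  have hex := fun k : Fin 2 => exists_forall_hasDerivAt_of_lipschitz (K := ‖z‖ + M + 1)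
    (by positivity) hF (fun t => by ext i; fin_cases i <;> simp [F]) hL
    (fun i => (1 : Matrix (Fin 2) (Fin 2) ℂ) i k)
  choose y hy0 hy using hex
  refine ⟨fun x => Matrix.of fun i k => y k x i, isFundamentalSolution_iff.2 ⟨?_, fun k x hx => ?_⟩⟩
  · ext i k
    simp [hy0]
  · have h0 := hasDerivAt_pi.1 (hy k x) 0
    have h1 := hasDerivAt_pi.1 (hy k x) 1
    simp only [F, abs_of_nonneg hx] at h0 h1
    exact ⟨h0.hasDerivWithinAt, h1.hasDerivWithinAt⟩

theorem star_dotProduct_gram (A : Matrix (Fin 2) (Fin 2) ℂ) (h : Fin 2 → ℂ) :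
    star h ⬝ᵥ ((Aᴴ * A) *ᵥ h) = ((‖(A *ᵥ h) 0‖ ^ 2 + ‖(A *ᵥ h) 1‖ ^ 2 : ℝ) : ℂ) := by
  rw [← Matrix.mulVec_mulVec, Matrix.dotProduct_mulVec, Matrix.vecMul_conjTranspose, star_star,
    dotProduct, Fin.sum_univ_two]
  push_cast
  rw [← Complex.conj_mul', ← Complex.conj_mul']
  rfl

theorem IsFundamentalSolution.isSpectralSolution (hY : IsFundamentalSolution v z Y)
    (h : Fin 2 → ℂ) :
    IsSpectralSolution v z (fun x => (Y x *ᵥ h) 0) (fun x => (Y x *ᵥ h) 1) := by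
  have h1 := (isFundamentalSolution_iff.1 hY).2
  convert (h1 0).add_mul (h1 1) (h 0) (h 1) using 2
  · simp [Matrix.mulVec, dotProduct, Fin.sum_univ_two, mul_comm]
  · simp [Matrix.mulVec, dotProduct, Fin.sum_univ_two, mul_comm]

/-- A nontrivial decaying solution spans the square summable solutions. -/
theorem squareSummableAlong_iff {M D δ : ℝ} (hv : ContinuousOn v (Ici 0))
    (hM : ∀ x, 0 ≤ x → ‖v x‖ ≤ M) (hδ : 0 < δ) (hy : IsSpectralSolution v z y₁ y₂)
    (hc₁ : Continuous y₁) (hc₂ : Continuous y₂) (h0 : y₁ 0 ≠ 0)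
    (hD₁ : ∀ x, 0 ≤ x → ‖y₁ x‖ ≤ D * Real.exp (-δ * x))
    (hD₂ : ∀ x, 0 ≤ x → ‖y₂ x‖ ≤ D * Real.exp (-δ * x)) (h : Fin 2 → ℂ) :
    SquareSummableAlong v z h ↔ h 1 * y₁ 0 = h 0 * y₂ 0 := by
  have hD0 : 0 ≤ D := by simpa using (norm_nonneg _).trans (hD₁ 0 le_rfl)
  constructor
  · rintro ⟨Y, hY, hint⟩
    simp only [star_dotProduct_gram] at hint
    have hu := hY.isSpectralSolution h
    have hY0 : Y 0 *ᵥ h = h := by rw [hY.1, Matrix.one_mulVec]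
    set c := y₁ 0 * h 1 - y₂ 0 * h 0 with hc
    have hW : ∀ x, 0 ≤ x → c = y₁ x * (Y x *ᵥ h) 1 - y₂ x * (Y x *ᵥ h) 0 := fun x hx => by
      rw [hy.wronskian_eq hu hx, hY0]
    have hle : ∀ x, 0 < x → ‖c‖ ^ 2 ≤
        2 * D ^ 2 * ‖(((‖(Y x *ᵥ h) 0‖ ^ 2 + ‖(Y x *ᵥ h) 1‖ ^ 2 : ℝ)) : ℂ)‖ := fun x hx => by
      rw [Complex.norm_real, Real.norm_of_nonneg (by positivity)]
      have he : Real.exp (-δ * x) ≤ 1 := Real.exp_le_one_iff.2 (by nlinarith)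
      have b1 : ‖y₁ x‖ ≤ D := (hD₁ x hx.le).trans (mul_le_of_le_one_right hD0 he)
      have b2 : ‖y₂ x‖ ≤ D := (hD₂ x hx.le).trans (mul_le_of_le_one_right hD0 he)
      have b3 : ‖c‖ ≤ D * ‖(Y x *ᵥ h) 1‖ + D * ‖(Y x *ᵥ h) 0‖ := by
        rw [hW x hx.le]
        refine (norm_sub_le _ _).trans ?_
        rw [norm_mul, norm_mul]
        gcongr
      calc ‖c‖ ^ 2 ≤ (D * ‖(Y x *ᵥ h) 1‖ + D * ‖(Y x *ᵥ h) 0‖) ^ 2 := by gcongr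
        _ ≤ _ := by nlinarith [sq_nonneg (D * ‖(Y x *ᵥ h) 1‖ - D * ‖(Y x *ᵥ h) 0‖)]
    have hconst : IntegrableOn (fun _ : ℝ => ‖c‖ ^ 2) (Ioi 0) := by
      refine Integrable.mono' (hint.norm.const_mul (2 * D ^ 2)) aestronglyMeasurable_const ?_
      filter_upwards [ae_restrict_mem measurableSet_Ioi] with x hx
      rw [Real.norm_of_nonneg (by positivity)]
      exact hle x hx
    have hc0 : c = 0 := by
      rw [integrableOn_const_iff] at hconst
      simpa using hconst
    linear_combination hc0
  · intro hh
    obtain ⟨Y, hY⟩ := exists_isFundamentalSolution hv hM z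
    refine ⟨Y, hY, ?_⟩
    have hYs := (isFundamentalSolution_iff.1 hY).2
    have hY0 : Y 0 *ᵥ h = h := by rw [hY.1, Matrix.one_mulVec]
    set c := h 0 / y₁ 0 with hc
    have e0 : c * y₁ 0 = h 0 := by rw [hc]; field_simp
    have e1 : c * y₂ 0 = h 1 := by rw [hc, div_mul_eq_mul_div, ← hh]; field_simp
    have hd := (hY.isSpectralSolution h).add_mul hy 1 (-c)
    have hzero : ∀ x, 0 ≤ x → (Y x *ᵥ h) 0 = c * y₁ x ∧ (Y x *ᵥ h) 1 = c * y₂ x := by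
      intro x hx
      have w0 := hd.wronskian_eq (hYs 0) hx
      have w1 := hd.wronskian_eq (hYs 1) hx
      have w2 := (hYs 0).wronskian_eq (hYs 1) hx
      simp only [hY0, e0, e1, one_mul, neg_mul, add_neg_cancel, zero_mul, sub_zero] at w0 w1
      simp only [hY.1, Matrix.one_apply_eq, Matrix.one_apply_ne one_ne_zero,
        Matrix.one_apply_ne zero_ne_one] at w2
      constructor
      · linear_combination (Y x 0 0) * w1 - (Y x 0 1) * w0 -
          ((Y x *ᵥ h) 0 - c * y₁ x) * w2
      · linear_combination (Y x 1 0) * w1 - (Y x 1 1) * w0 -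
          ((Y x *ᵥ h) 1 - c * y₂ x) * w2
    simp only [star_dotProduct_gram]
    have hcont : Continuous fun x : ℝ => ((‖c * y₁ x‖ ^ 2 + ‖c * y₂ x‖ ^ 2 : ℝ) : ℂ) := by fun_prop
    have hi : IntegrableOn (fun x : ℝ => ((‖c * y₁ x‖ ^ 2 + ‖c * y₂ x‖ ^ 2 : ℝ) : ℂ)) (Ioi 0) := by
      refine Integrable.mono' ((integrableOn_exp_mul_Ioi (a := -(2 * δ)) (by linarith)
        0).const_mul (2 * ‖c‖ ^ 2 * D ^ 2)) hcont.aestronglyMeasurable ?_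
      filter_upwards [ae_restrict_mem measurableSet_Ioi] with x hx
      have hx : 0 < x := hx
      rw [Complex.norm_real, Real.norm_of_nonneg (by positivity), norm_mul, norm_mul]
      calc _ ≤ (‖c‖ * (D * Real.exp (-δ * x))) ^ 2 + (‖c‖ * (D * Real.exp (-δ * x))) ^ 2 := by
            gcongr
            · exact hD₁ x hx.le
            · exact hD₂ x hx.le
        _ = 2 * ‖c‖ ^ 2 * D ^ 2 * (Real.exp (-δ * x) * Real.exp (-δ * x)) := by ring
        _ = _ := by rw [← Real.exp_add]; ring_nf
    refine hi.congr_fun (fun x hx => ?_) measurableSet_Ioi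
    have hx : 0 < x := hx
    simp only [(hzero x hx.le).1, (hzero x hx.le).2]

theorem norm_snd_le_norm_fst_of_decaying {w : ℝ → ℂ} {D δ : ℝ} (hz : 0 < z.im) (hδ : 0 < δ)
    (hd₁ : ∀ x, HasDerivAt y₁ (I * z * y₁ x - I * conj (w x) * y₂ x) x)
    (hd₂ : ∀ x, HasDerivAt y₂ (-I * z * y₂ x + I * w x * y₁ x) x)
    (hD₂ : ∀ x, 0 ≤ x → ‖y₂ x‖ ≤ D * Real.exp (-δ * x)) : ‖y₂ 0‖ ≤ ‖y₁ 0‖ := by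
  have hN : ∀ x, HasDerivAt (fun x => ‖y₂ x‖ ^ 2 - ‖y₁ x‖ ^ 2)
      (2 * z.im * (‖y₁ x‖ ^ 2 + ‖y₂ x‖ ^ 2)) x := fun x => by
    refine ((hd₂ x).norm_sq.sub (hd₁ x).norm_sq).congr_deriv ?_
    simp only [Complex.inner, ← Complex.normSq_eq_norm_sq, Complex.normSq_apply]
    simp
    ring
  have hmono : Monotone fun x => ‖y₂ x‖ ^ 2 - ‖y₁ x‖ ^ 2 :=
    monotone_of_hasDerivAt_nonneg hN fun x => by positivity
  have hlim : Tendsto (fun x : ℝ => (D * Real.exp (-δ * x)) ^ 2) atTop (𝓝 0) := by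
    have h1 : Tendsto (fun x : ℝ => Real.exp (-δ * x)) atTop (𝓝 0) :=
      Real.tendsto_exp_atBot.comp (tendsto_id.const_mul_atTop_of_neg (neg_lt_zero.2 hδ))
    simpa using (h1.const_mul D).pow 2
  have h0 : ‖y₂ 0‖ ^ 2 - ‖y₁ 0‖ ^ 2 ≤ 0 := by
    refine ge_of_tendsto hlim ?_
    filter_upwards [eventually_ge_atTop 0] with x hx
    have h1 : ‖y₂ 0‖ ^ 2 - ‖y₁ 0‖ ^ 2 ≤ ‖y₂ x‖ ^ 2 - ‖y₁ x‖ ^ 2 := hmono hx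
    have h2 : ‖y₂ x‖ ^ 2 ≤ (D * Real.exp (-δ * x)) ^ 2 := by gcongr; exact hD₂ x hx
    nlinarith [sq_nonneg ‖y₁ x‖]
  exact (sq_le_sq₀ (norm_nonneg _) (norm_nonneg _)).1 (by linarith)

theorem norm_complexPotential_le {p q : ℝ → ℝ} {M : ℝ}
    (hM : ∀ x, 0 ≤ x → ‖Matrix.toEuclideanCLM (n := Fin 2) (𝕜 := ℂ) (dynV p q x)‖ ≤ M) (x : ℝ) :
    ‖complexPotential p q x‖ ≤ M := by
  have h1 := (Matrix.toEuclideanCLM (n := Fin 2) (𝕜 := ℂ) (dynV p q |x|)).le_opNorm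
    (EuclideanSpace.single 0 1)
  rw [PiLp.norm_single, norm_one, mul_one] at h1
  have h2 : ‖complexPotential p q x‖ = ‖Matrix.toEuclideanCLM (n := Fin 2) (𝕜 := ℂ)
      (dynV p q |x|) (EuclideanSpace.single 0 1)‖ := by
    rw [EuclideanSpace.norm_eq, Fin.sum_univ_two, complexPotential, mul_comm,
      Complex.norm_add_mul_I]
    have e : ∀ i, Matrix.toEuclideanCLM (n := Fin 2) (𝕜 := ℂ) (dynV p q |x|)
        (EuclideanSpace.single 0 1) i = dynV p q |x| i 0 := fun i => by
      rw [Matrix.ofLp_toEuclideanCLM]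
      fin_cases i <;> simp [Matrix.mulVec, dotProduct]
    rw [e, e]
    simp [dynV]
  exact h2.trans_le (h1.trans (hM _ (abs_nonneg x)))

end Spectral

end
theorem mainTheorem2 (p q : ℝ → ℝ)
    (hp : ContDiffOn ℝ 1 p (Ici 0)) (hq : ContDiffOn ℝ 1 q (Ici 0))
    (M₁ : ℝ)
    (hM₁ : ∀ x, 0 ≤ x → ‖Matrix.toEuclideanCLM (n := Fin 2) (𝕜 := ℂ) (dynV p q x)‖ ≤ M₁) :
    (∃ r, IsResponseFunction p q r) ∧
    ∀ r, IsResponseFunction p q r →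
      ∀ z : ℂ, 2 * Real.sqrt 2 * M₁ < z.im →
        IntegrableOn (fun t : ℝ => exp (I * z * t) * r t) (Ioi 0) ∧
        fourierLaplace r z + 2 * I ≠ 0 ∧
        (∀ w, IsWeylValue (fun x => I * q x - p x) z w ↔
          w = fourierLaplace r z / (fourierLaplace r z + 2 * I)) ∧
        (∀ w, IsHerglotzWeylValue (fun x => I * q x - p x) z w ↔
          w = fourierLaplace r z + I) := by
  have hw := continuous_complexPotential hp.continuousOn hq.continuousOn
  have hwM := norm_complexPotential_le hM₁
  have hM0 : 0 ≤ M₁ := (norm_nonneg _).trans (hwM 0)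
  refine ⟨?_, fun r hr z hz => ?_⟩
  · obtain ⟨a, b, C, ha, hb, -, -, hab, hba⟩ := exists_impulseResponse hw hwM (lt_add_one M₁)
    exact ⟨_, isResponseFunction_of_impulseResponse hw ha hb hab hba⟩
  have hMz : M₁ < z.im := by
    have h1 : 1 ≤ Real.sqrt 2 := Real.one_le_sqrt.2 one_le_two
    nlinarith
  obtain ⟨κ, hMκ, hκz⟩ := exists_between hMz
  obtain ⟨a, b, C, ha, hb, haC, hbC, hab, hba⟩ := exists_impulseResponse hw hwM hMκ
  have hra := hr.eq_of_impulseResponse hw ha hb hab hba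
  obtain ⟨y₁, y₂, D, h1, h2, hd₁, hd₂, hD₁, hD₂⟩ :=
    exists_decaying_solution hw hwM hMκ hκz ha hb haC hbC hab hba
  set A := laplaceSnd z a 0 with hA
  have hδ : 0 < z.im - κ := sub_pos.2 hκz
  have hR : fourierLaplace r z = -I * A := by
    rw [hA, laplaceSnd, ← integral_const_mul]
    refine setIntegral_congr_fun measurableSet_Ioi fun t ht => ?_
    rw [hra t (le_of_lt ht)]
    ring
  have hint : IntegrableOn (fun t : ℝ => exp (I * z * t) * r t) (Ioi 0) := by
    refine IntegrableOn.congr_fun (f := fun t : ℝ => -I * (cexp (I * z * t) * a 0 t))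
      ((integrableOn_laplace ha haC hκz 0).const_mul (-I)) (fun t ht => ?_) measurableSet_Ioi
    simp only
    rw [hra t (le_of_lt ht)]
    ring
  have hv : ContinuousOn (fun x => I * (q x : ℂ) - p x) (Ici 0) :=
    (continuousOn_const.mul (continuous_ofReal.comp_continuousOn hq.continuousOn)).sub
      (continuous_ofReal.comp_continuousOn hp.continuousOn)
  have hconj : ∀ x, 0 ≤ x → I * (q x : ℂ) - p x =
      -(starRingEnd ℂ) (complexPotential p q x) := fun x hx => by
    simp [complexPotential, abs_of_nonneg hx]
    ring
  have hvM : ∀ x, 0 ≤ x → ‖I * (q x : ℂ) - p x‖ ≤ M₁ := fun x hx => by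
    rw [hconj x hx, norm_neg, RCLike.norm_conj]
    exact hwM x
  have hy : IsSpectralSolution (fun x => I * (q x : ℂ) - p x) z y₁ y₂ := fun x hx => by
    refine ⟨(hd₁ x).hasDerivWithinAt.congr_deriv ?_, (hd₂ x).hasDerivWithinAt.congr_deriv ?_⟩
    · simp only
      rw [hconj x hx]; ring
    · simp only
      rw [hconj x hx, map_neg, Complex.conj_conj]; ring
  have hc₁ : Continuous y₁ := continuous_iff_continuousAt.2 fun x => (hd₁ x).continuousAt
  have hc₂ : Continuous y₂ := continuous_iff_continuousAt.2 fun x => (hd₂ x).continuousAt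
  have h0 : y₁ 0 ≠ 0 := fun h => by
    have h3 := norm_snd_le_norm_fst_of_decaying (hM0.trans_lt hMz) hδ hd₁ hd₂ hD₂
    rw [h, norm_zero, norm_le_zero_iff, h2] at h3
    rw [h1] at h
    have : (2 : ℂ) = 0 := by linear_combination h - h3
    exact two_ne_zero this
  have key := squareSummableAlong_iff hv hvM hδ hy hc₁ hc₂ h0 hD₁ hD₂
  have hA2 : 2 - A ≠ 0 := h1 ▸ h0
  have hR2 : -I * A + 2 * I ≠ 0 := by
    rw [show -I * A + 2 * I = I * (2 - A) by ring]
    exact mul_ne_zero I_ne_zero hA2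
  refine ⟨hint, by rwa [hR], fun w => ?_, fun w => ?_⟩
  · rw [IsWeylValue, key, h1, h2, hR, eq_div_iff hR2]
    simp only [Matrix.cons_val_zero, Matrix.cons_val_one, one_mul]
    constructor <;> intro h
    · linear_combination I * h
    · linear_combination (-I) * h + (w * (2 - A) + A) * I_sq
  · rw [IsHerglotzWeylValue, key, h1, h2, hR]
    have hs : ((Real.sqrt 2 : ℝ) : ℂ)⁻¹ ≠ 0 := by simp
    have e0 : (herglotzKᴴ *ᵥ ![1, -I * w]) 0 = ((Real.sqrt 2 : ℝ) : ℂ)⁻¹ * (1 - I * w) := by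
      simp [herglotzK, Matrix.mulVec, dotProduct, Fin.sum_univ_two]
      ring
    have e1 : (herglotzKᴴ *ᵥ ![1, -I * w]) 1 = ((Real.sqrt 2 : ℝ) : ℂ)⁻¹ * (-1 - I * w) := by
      simp [herglotzK, Matrix.mulVec, dotProduct, Fin.sum_univ_two]
      ring
    rw [e0, e1, mul_assoc, mul_assoc, mul_right_inj' hs]
    constructor <;> intro h
    · linear_combination (I / 2) * h + w * I_sq
    · linear_combination (-2 * I) * h + (2 * A - 2) * I_sq
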